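/- Consider the Hubbard model in the Hartree–Fock mean-field approximation at half-filling, with nearest-neighbour hopping $t=1$ in the $x$- and $y$-directions and $t_z$ in the $z$-direction, and let $$\varepsilon(\mathbf k) = -2(\cos k_1+\cos k_2) - 2t_z\cos k_3,\qquad \mathbf k\in[-\pi,\pi]^3 .$$ For $U>0$ the Néel temperature $T_N(U,t_z)$ is the unique solution $T_N>0$ of $$1=\int_{[-\pi,\pi]^3}\frac{U\tanh\big(\frac{\varepsilon(\mathbf k)}{2T_N}\big)}{2\,\varepsilon(\mathbf k)}\,\frac{dk_1dk_2dk_3}{(2\pi)^3},$$ and the density of states is $N_{t_z}(\epsilon)=\int_{[-\pi,\pi]^3}\delta(\varepsilon(\mathbf k)-\epsilon)\frac{dk_1dk_2dk_3}{(2\pi)^3}$, i.e. the Lebesgue density of the distribution of $\varepsilon(\mathbf k)$ for $\mathbf k$ uniformly distributed in $[-\pi,\pi]^3$. The case $t_z=0$ is the two-dimensional model. **Theorem.** For $t_z=0$ the Néel temperature $T_N(U,0)$ (which exists and is unique for every $U>0$) and the density of states $N_0$ are well defined, and $$T_N(U,0)=\frac{32}{\pi e^{-\gamma}}\,e^{-\sqrt{\frac{4\pi^2}{U}+a_1}}\Big(1+O\big(e^{-\frac{4\pi}{\sqrt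 U}}\big)\Big)\qquad\text{as } U\downarrow 0,$$ where $\gamma$ is Euler's constant and the constant $a_1$, given by the convergent integrals $$a_1=-4\pi^2\int_0^4\Big(N_0(\epsilon)-\frac{\ln(16/\epsilon)}{2\pi^2}\Big)\frac{d\epsilon}{\epsilon}-\int_0^\infty\frac{(\ln x)^2}{\cosh^2x}\,dx+(2\ln2)^2+(\gamma+2\ln 2-\ln\pi)^2,$$ satisfies $a_1\approx0.3260$ (correct to the four decimals displayed, i.e. $|a_1-0.3260|\le 5\cdot10^{-5}$). -/

import Mathlib

open MeasureTheory Filter Topology Asymptotics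

noncomputable section

namespace Hubbard

/-- The cube `[-π, π]³` of momenta. -/
def momentumCube : Set (ℝ × ℝ × ℝ) :=
  Set.Icc (-Real.pi) Real.pi ×ˢ (Set.Icc (-Real.pi) Real.pi ×ˢ Set.Icc (-Real.pi) Real.pi)

/-- The normalized Lebesgue measure `dk₁ dk₂ dk₃ / (2π)³` on the cube `[-π, π]³`. -/
def momentumMeasure : Measure (ℝ × ℝ × ℝ) :=
  (ENNReal.ofReal ((2 * Real.pi) ^ 3))⁻¹ • volume.restrict momentumCube

/-- The tight-binding band relation
`ε(k) = -2 (cos k₁ + cos k₂) - 2 t_z cos k₃`, with `t = 1`. -/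
def band (tz : ℝ) (k : ℝ × ℝ × ℝ) : ℝ :=
  -2 * (Real.cos k.1 + Real.cos k.2.1) - 2 * tz * Real.cos k.2.2

/-- `T` is a positive solution of the equation
`1 = ∫ U tanh(ε(k) / (2T)) / (2 ε(k)) dk / (2π)³` over `[-π, π]³`. -/
def IsNeelTemperature (U tz T : ℝ) : Prop :=
  0 < T ∧
    1 = ∫ k, U * Real.tanh (band tz k / (2 * T)) / (2 * band tz k) ∂momentumMeasure

/-- The Néel temperature `T_N(U, t_z)`: the solution `T` of `IsNeelTemperature U tz T`
(its existence and uniqueness make the infimum below the infimum of a singleton). -/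
def neelTemperature (U tz : ℝ) : ℝ :=
  sInf {T : ℝ | IsNeelTemperature U tz T}

/-- The distribution of the band energy `ε(k)` when `k` is uniformly distributed in
`[-π, π]³`. -/
def bandEnergyLaw (tz : ℝ) : Measure ℝ :=
  momentumMeasure.map (band tz)

/-- The density of states `N_{t_z}(ε) = ∫ δ(ε(k) - ε) dk / (2π)³`, i.e. the Lebesgue density
of the distribution of the band energy. -/
def densityOfStates (tz ε : ℝ) : ℝ :=
  ((bandEnergyLaw tz).rnDeriv volume ε).toReal

/-- The integrand `(N_0(ε) - ln(16/ε) / (2π²)) / ε`. -/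
def densityRemainder (ε : ℝ) : ℝ :=
  (densityOfStates 0 ε - Real.log (16 / ε) / (2 * Real.pi ^ 2)) * (1 / ε)

/-- The constant `a₁`. -/
def a₁ : ℝ :=
  -4 * Real.pi ^ 2 * (∫ ε in (0 : ℝ)..4, densityRemainder ε)
    - (∫ x in Set.Ioi (0 : ℝ), Real.log x ^ 2 / Real.cosh x ^ 2)
    + (2 * Real.log 2) ^ 2
    + (Real.eulerMascheroniConstant + 2 * Real.log 2 - Real.log Real.pi) ^ 2

end Hubbard

end

noncomputable section

namespace Hubbard

open Set Real
open scoped ENNReal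

/-! ### Changes of variables for the lower Lebesgue integral -/

/-! At `tz = 0` the addition formulas turn `-2 (cos p + cos q)` into `-4` times a product of two
cosines of independent uniform angles. The law of `|ε| / 4` is therefore the multiplicative
convolution of two arcsine laws, and `N_0(ε) = K(|ε|/4) / (2π²)` almost everywhere, with `K(u) = ∫
ρ(x) ρ(u/x) dx/x` and `ρ(x) = (1 - x²)^(-1/2)` (`lintegral_bandEnergyLaw`). Writing `ρ = 1 + e` on
`(0, 1)` splits `K` into `log (1/u)`, an elementary logarithm and the convolution of `e` with itself
(`bandKernel_eq`). Hence `R(u) = K(u) - log (4/u)` is bounded by `u² (2 + K(u))`, and `∫ R(u) du/u =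
2 log² 2 - π²/12` exactly.

The gap equation becomes `G(a) = 2π²/U` with `a = 2/T` and `G(a) = ∫_0^1 K(u) tanh(au) du/u`. The
function `G` is continuous, strictly increasing, zero at `0` and unbounded, which gives existence
and uniqueness. For the asymptotics, the part of `G` coming from `log (4/u)` is integrated by parts,
which leaves logarithmic moments of `1/cosh²`. With `Y = log (32 e^γ / (π T))` the outcome is `2
G(a) = Y² - a₁ + O(Y/a²)` (`exists_gapIntegral_bound`). Dividing by `√(4π²/U + a₁) + Y` gives `Y =
√(4π²/U + a₁) + O(T²)`, and exponentiating gives the formula, since `T² = O(e^(-4π/√U))`.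

The moments come from `∫ log t e^(-t) = -γ` and `∫ log² t e^(-t) = γ² + π²/6`, applied termwise to
the expansion of `1/cosh²` in powers of `e^(-2x)`. The first moment of `1/cosh²` is exact by Wallis'
product (`integral_shiftedLog_sech`). The second is enclosed by a truncated Euler transform with a
remainder of known sign. Everything else in `a₁` cancels down to `log² (π/2) + π²/6` minus this
second moment (`a₁_eq`), so finitely many logarithms yield the decimals. -/

theorem setLIntegral_preimage_affine {c : ℝ} (hc : c ≠ 0) (d : ℝ) {s : Set ℝ}
    (hs : MeasurableSet s) (F : ℝ → ℝ≥0∞) :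
    ∫⁻ y in s, F y = ENNReal.ofReal |c| * ∫⁻ x in (fun x => c * x + d) ⁻¹' s, F (c * x + d) := by
  have hsurj : Function.Surjective (fun x : ℝ => c * x + d) := fun y => ⟨(y - d) / c, by
    field_simp; ring⟩
  have hm : MeasurableSet ((fun x : ℝ => c * x + d) ⁻¹' s) := by
    apply MeasurableSet.preimage hs; fun_prop
  conv_lhs => rw [← Set.image_preimage_eq s hsurj]
  rw [lintegral_image_eq_lintegral_abs_deriv_mul (f' := fun _ => c) hm, lintegral_const_mul' _ _ (by simp)]
  · intro x _
    simpa using (((hasDerivAt_id x).const_mul c).add_const d).hasDerivWithinAt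
  · intro x _ y _ h
    simpa [hc] using h

theorem lintegral_affine {c : ℝ} (hc : c ≠ 0) (d : ℝ) (F : ℝ → ℝ≥0∞) :
    ∫⁻ y, F y = ENNReal.ofReal |c| * ∫⁻ x, F (c * x + d) := by
  simpa using setLIntegral_preimage_affine hc d MeasurableSet.univ F

theorem setLIntegral_Ioc_of_periodic {F : ℝ → ℝ≥0∞} {T : ℝ} (hT : 0 < T)
    (hF : Function.Periodic F T) (s t : ℝ) :
    ∫⁻ x in Ioc s (s + T), F x = ∫⁻ x in Ioc t (t + T), F x :=
  (isAddFundamentalDomain_Ioc hT s).setLIntegral_eq (isAddFundamentalDomain_Ioc hT t) F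
    hF.map_vadd_zmultiples

/-- Averages over a period of `F (p + d)` and of `F p` agree. -/
theorem setLIntegral_periodic_add {F : ℝ → ℝ≥0∞} (hF : Function.Periodic F (2 * π)) (d : ℝ) :
    ∫⁻ p in Ioc (-π) π, F (p + d) = ∫⁻ p in Ioc (-π) π, F p := by
  have h1 := setLIntegral_preimage_affine (one_ne_zero) d
    (measurableSet_Ioc (a := -π + d) (b := -π + d + 2 * π)) F
  have h2 : (fun x : ℝ => 1 * x + d) ⁻¹' Ioc (-π + d) (-π + d + 2 * π) = Ioc (-π) π := by
    ext x; simp only [mem_preimage, mem_Ioc]; constructor <;> rintro ⟨h, h'⟩ <;>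
      constructor <;> linarith
  rw [h2] at h1
  simp only [one_mul, abs_one, ENNReal.ofReal_one] at h1
  rw [← h1, setLIntegral_Ioc_of_periodic (by positivity) hF (-π + d) (-π)]
  congr 3; ring

/-- Averages over a period of `F (p - 2 q)` and of `F q` agree. -/
theorem setLIntegral_periodic_sub_two_mul {F : ℝ → ℝ≥0∞} (hF : Function.Periodic F (2 * π))
    (p : ℝ) :
    ∫⁻ q in Ioc (-π) π, F (p - 2 * q) = ∫⁻ q in Ioc (-π) π, F q := by
  have h1 := setLIntegral_preimage_affine (c := -2) (by norm_num) p
    (measurableSet_Ico (a := p - 2 * π) (b := p)) F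
  have h2 : (fun x : ℝ => -2 * x + p) ⁻¹' Ico (p - 2 * π) p = Ioc 0 (0 + π) := by
    ext x; simp only [mem_preimage, mem_Ioc, mem_Ico]; constructor <;> rintro ⟨h, h'⟩ <;>
      constructor <;> linarith
  -- The map `q ↦ p - 2q` runs through two periods while `q` runs through one. Each half of the
  -- interval thus gives one full period, and the resulting factor 2 cancels the Jacobian.
  have h3 : Function.Periodic (fun q => F (p - 2 * q)) π := fun q => by
    have := hF (p - 2 * (q + π))
    simp only at this ⊢
    rw [← this]; congr 1; ring
  have h4 := setLIntegral_Ioc_of_periodic pi_pos h3 (-π) 0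
  have h5 : Ioc (-π) π = Ioc (-π) (-π + π) ∪ Ioc 0 (0 + π) := by
    rw [neg_add_cancel, zero_add, Ioc_union_Ioc_eq_Ioc] <;> linarith [pi_pos]
  conv_lhs => rw [h5]
  rw [lintegral_union measurableSet_Ioc, h4, ← two_mul]
  · have h6 : ∫⁻ y in Ico (p - 2 * π) p, F y = ∫⁻ y in Ioc (p - 2 * π) (p - 2 * π + 2 * π), F y := by
      rw [sub_add_cancel]; exact setLIntegral_congr Ico_ae_eq_Ioc
    rw [h6, h2, setLIntegral_Ioc_of_periodic (by positivity) hF (p - 2 * π) (-π)] at h1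
    rw [show -π + 2 * π = π by ring] at h1
    rw [h1]
    congr 1
    · simp
    · simp only [sub_eq_add_neg, neg_mul, add_comm]
  · rw [Set.disjoint_left]; intro x hx hx'
    simp only [mem_Ioc] at hx hx'; linarith

/-- The unnormalized density of `cos p` for uniformly distributed `p`; it vanishes off `(-1, 1)`. -/
def arcsineDensity (x : ℝ) : ℝ := (√(1 - x ^ 2))⁻¹

theorem arcsineDensity_nonneg (x : ℝ) : 0 ≤ arcsineDensity x := by
  unfold arcsineDensity; positivity

theorem arcsineDensity_neg (x : ℝ) : arcsineDensity (-x) = arcsineDensity x := by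
  simp [arcsineDensity]

/-- The conventions `√y = 0` for `y ≤ 0` and `0⁻¹ = 0` perform the truncation, so no indicator
functions are needed later. -/
theorem arcsineDensity_of_one_le {x : ℝ} (hx : 1 ≤ x) : arcsineDensity x = 0 := by
  rw [arcsineDensity, Real.sqrt_eq_zero_of_nonpos (by nlinarith), inv_zero]

theorem arcsineDensity_abs (x : ℝ) : arcsineDensity |x| = arcsineDensity x := by
  simp [arcsineDensity]

@[fun_prop]
theorem measurable_arcsineDensity : Measurable arcsineDensity := by
  unfold arcsineDensity; fun_prop

/-- On `(0, π)` the cosine is injective onto `(-1, 1)` with `|cos'| = √(1 - x²)`. Evenness supplies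
the other half of the period, hence the factor 2. -/
theorem setLIntegral_comp_cos (F : ℝ → ℝ≥0∞) :
    ∫⁻ p in Ioc (-π) π, F (cos p) = 2 * ∫⁻ x, F x * ENNReal.ofReal (arcsineDensity x) := by
  have himg : cos '' Ioo 0 π = Ioo (-1) 1 := by
    ext y; constructor
    · rintro ⟨x, ⟨h0, h1⟩, rfl⟩
      refine ⟨?_, ?_⟩
      · rw [← cos_pi]; exact strictAntiOn_cos ⟨h0.le, h1.le⟩ ⟨pi_pos.le, le_rfl⟩ h1
      · rw [← cos_zero]; exact strictAntiOn_cos ⟨le_rfl, pi_pos.le⟩ ⟨h0.le, h1.le⟩ h0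
    · rintro ⟨h0, h1⟩
      refine ⟨arccos y, ⟨arccos_pos.2 h1, ?_⟩, cos_arccos h0.le h1.le⟩
      exact lt_of_le_of_ne (arccos_le_pi y) (fun h => by rw [arccos_eq_pi] at h; linarith)
  have hsupp : ∫⁻ x, F x * ENNReal.ofReal (arcsineDensity x)
      = ∫⁻ x in Ioo (-1) 1, F x * ENNReal.ofReal (arcsineDensity x) := by
    rw [setLIntegral_eq_of_support_subset]
    intro x hx
    by_contra hx'
    apply hx
    have : 1 ≤ |x| := by
      by_contra h; push Not at h; exact hx' (abs_lt.1 h)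
    simp only [← arcsineDensity_abs x, arcsineDensity_of_one_le this, ENNReal.ofReal_zero, mul_zero]
  have hhalf : ∫⁻ p in Ioo 0 π, F (cos p) = ∫⁻ x, F x * ENNReal.ofReal (arcsineDensity x) := by
    rw [hsupp, ← himg, lintegral_image_eq_lintegral_abs_deriv_mul (f' := fun x => -sin x)
      measurableSet_Ioo (fun x _ => (hasDerivAt_cos x).hasDerivWithinAt)
      ((injOn_cos).mono Ioo_subset_Icc_self)]
    refine setLIntegral_congr_fun measurableSet_Ioo fun x hx => ?_
    have hs := sin_pos_of_pos_of_lt_pi hx.1 hx.2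
    simp only [arcsineDensity, ← sin_sq, abs_neg, Real.sqrt_sq_eq_abs, abs_of_pos hs]
    rw [mul_comm (F _), ← mul_assoc, ← ENNReal.ofReal_mul hs.le, mul_inv_cancel₀ hs.ne']
    simp
  have h5 : Ioc (-π) π = Ioc (-π) 0 ∪ Ioc 0 π := by
    rw [Ioc_union_Ioc_eq_Ioc] <;> linarith [pi_pos]
  rw [h5, lintegral_union measurableSet_Ioc, two_mul]
  · congr 1
    · rw [← hhalf, setLIntegral_congr (Ioo_ae_eq_Ioc (a := -π) (b := 0)).symm,
        setLIntegral_preimage_affine (c := -1) (by norm_num) 0 measurableSet_Ioo]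
      have h2 : (fun x : ℝ => -1 * x + 0) ⁻¹' Ioo (-π) 0 = Ioo 0 π := by
        ext x; simp only [mem_preimage, mem_Ioo]; constructor <;> rintro ⟨h, h'⟩ <;>
          constructor <;> linarith
      rw [h2]; simp
    · rw [← hhalf, setLIntegral_congr Ioo_ae_eq_Ioc]
  · rw [Set.disjoint_left]; intro x hx hx'
    simp only [mem_Ioc] at hx hx'; linarith

/-! ### The law of the band energy -/

/-- The complete elliptic integral `∫_u^1 dx / √((1 - x²)(x² - u²))`. -/
def bandKernel (u : ℝ) : ℝ≥0∞ :=
  ∫⁻ x in Ioi 0, ENNReal.ofReal (arcsineDensity x * arcsineDensity (u / x) / x)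

theorem measurable_bandKernel : Measurable bandKernel := by
  unfold bandKernel
  exact Measurable.lintegral_prod_right (f := fun u x : ℝ => ENNReal.ofReal
    (arcsineDensity x * arcsineDensity (u / x) / x)) (by fun_prop)

/-- The third momentum is inert and contributes `2π`, turning `(2π)⁻³` into `(2π)⁻²`. Half-open
intervals are used because they are fundamental domains for the translations. -/
theorem lintegral_momentumMeasure {G : ℝ → ℝ → ℝ≥0∞} (hG : Measurable (Function.uncurry G)) :
    ∫⁻ k, G k.1 k.2.1 ∂momentumMeasure = ENNReal.ofReal ((2 * π) ^ 2)⁻¹ *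
      ∫⁻ p in Ioc (-π) π, ∫⁻ q in Ioc (-π) π, G p q := by
  have hr : volume.restrict momentumCube = (volume.restrict (Ioc (-π) π)).prod
      ((volume.restrict (Ioc (-π) π)).prod (volume.restrict (Ioc (-π) π))) := by
    rw [momentumCube, Measure.volume_eq_prod, ← Measure.prod_restrict, Measure.volume_eq_prod,
      ← Measure.prod_restrict, Measure.restrict_congr_set Ioc_ae_eq_Icc]
  have hm : Measurable fun k : ℝ × ℝ × ℝ => G k.1 k.2.1 :=
    hG.comp (by fun_prop : Measurable fun k : ℝ × ℝ × ℝ => (k.1, k.2.1))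
  rw [momentumMeasure, lintegral_smul_measure, hr, lintegral_prod _ hm.aemeasurable]
  have : ∀ p : ℝ, ∫⁻ y, G p y.1 ∂((volume.restrict (Ioc (-π) π)).prod (volume.restrict (Ioc (-π) π)))
      = ENNReal.ofReal (2 * π) * ∫⁻ q in Ioc (-π) π, G p q := by
    intro p
    have hp : Measurable fun y : ℝ × ℝ => G p y.1 :=
      hG.comp (by fun_prop : Measurable fun y : ℝ × ℝ => (p, y.1))
    rw [lintegral_prod _ hp.aemeasurable]
    simp only [lintegral_const, MeasurableSet.univ, Measure.restrict_apply, univ_inter,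
      Real.volume_Ioc]
    rw [lintegral_mul_const', mul_comm]
    · congr 2; ring
    · simp
  simp only [this]
  rw [lintegral_const_mul' _ _ ENNReal.ofReal_ne_top, smul_eq_mul, ← mul_assoc,
    ← ENNReal.ofReal_inv_of_pos (by positivity), ← ENNReal.ofReal_mul (by positivity)]
  congr 2
  field_simp

/-- The shift `q → p - 2q` followed by `p → p + q` replaces `cos p + cos q` by `2 cos q cos p`,
after which both cosines are integrated against the arcsine density. The density of their product is
a multiplicative convolution. -/
theorem lintegral_bandEnergyLaw {f : ℝ → ℝ≥0∞} (hf : Measurable f) :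
    ∫⁻ ε, f ε ∂bandEnergyLaw 0 =
      ∫⁻ ε, f ε * (ENNReal.ofReal (1 / (2 * π ^ 2)) * bandKernel (|ε| / 4)) := by
  have hband : Measurable (band 0) := by unfold band; fun_prop
  rw [bandEnergyLaw, lintegral_map hf hband]
  have e1 : ∀ k : ℝ × ℝ × ℝ, f (band 0 k) = f (-2 * (cos k.1 + cos k.2.1)) := by
    intro k; simp [band]
  simp only [e1]
  rw [lintegral_momentumMeasure (G := fun p q => f (-2 * (cos p + cos q)))
    (by unfold Function.uncurry; fun_prop)]
  have e2 : ∀ p : ℝ, ∫⁻ q in Ioc (-π) π, f (-2 * (cos p + cos q)) =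
      ∫⁻ q in Ioc (-π) π, f (-4 * cos q * cos (p + -q)) := by
    intro p
    rw [← setLIntegral_periodic_sub_two_mul (F := fun q => f (-2 * (cos p + cos q)))
      (fun q => by simp) p]
    refine lintegral_congr fun q => ?_
    congr 1
    have h1 : cos p = cos ((p - q) + q) := by ring_nf
    have h2 : cos (p - 2 * q) = cos ((p - q) - q) := by ring_nf
    rw [h1, h2, cos_add, cos_sub (p - q) q, ← sub_eq_add_neg]; ring
  have e3 : ∀ q : ℝ, ∫⁻ p in Ioc (-π) π, f (-4 * cos q * cos (p + -q)) =
      2 * ∫⁻ x, f (-4 * cos q * x) * ENNReal.ofReal (arcsineDensity x) := by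
    intro q
    rw [setLIntegral_periodic_add (F := fun p => f (-4 * cos q * cos p)) (fun q => by simp),
      setLIntegral_comp_cos (fun x => f (-4 * cos q * x))]
  simp only [e2]
  rw [lintegral_lintegral_swap (by fun_prop)]
  simp only [e3]
  rw [lintegral_const_mul' _ _ (by simp), setLIntegral_comp_cos
    (fun y => ∫⁻ x, f (-4 * y * x) * ENNReal.ofReal (arcsineDensity x))]
  -- For fixed `y` the variable `ε = -4 y x` replaces `x`; the excluded value `y = 0` is a null set.
  have e4 : ∀ᵐ y : ℝ, (∫⁻ x, f (-4 * y * x) * ENNReal.ofReal (arcsineDensity x)) *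
      ENNReal.ofReal (arcsineDensity y) = ∫⁻ ε, f ε * ENNReal.ofReal
        (arcsineDensity y * arcsineDensity (ε / (4 * y)) / (4 * |y|)) := by
    filter_upwards [compl_mem_ae_iff.2 (measure_singleton (0 : ℝ))] with y hy
    have hy : y ≠ 0 := hy
    rw [lintegral_affine (c := -4 * y) (by simp [hy]) 0 fun ε => f ε * ENNReal.ofReal
        (arcsineDensity y * arcsineDensity (ε / (4 * y)) / (4 * |y|)),
      ← lintegral_const_mul' _ _ ENNReal.ofReal_ne_top,
      ← lintegral_mul_const' _ _ ENNReal.ofReal_ne_top]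
    refine lintegral_congr fun x => ?_
    rw [add_zero]
    have : -4 * y * x / (4 * y) = -x := by field_simp
    rw [this, arcsineDensity_neg, abs_mul, show |(-4 : ℝ)| = 4 by norm_num, mul_left_comm,
      mul_assoc, ← ENNReal.ofReal_mul (arcsineDensity_nonneg x),
      ← ENNReal.ofReal_mul (by positivity)]
    congr 2
    have : |y| ≠ 0 := abs_ne_zero.2 hy
    field_simp
  rw [lintegral_congr_ae e4, lintegral_lintegral_swap (by fun_prop),
    ← lintegral_const_mul' _ _ (by simp), ← lintegral_const_mul' _ _ (by simp),
    ← lintegral_const_mul' _ _ (by simp)]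
  refine lintegral_congr fun ε => ?_
  rw [lintegral_const_mul _ (by fun_prop)]
  -- The half-lines `y > 0` and `y < 0` contribute equally, `1/4` each.
  have e5 : ∫⁻ y, ENNReal.ofReal (arcsineDensity y * arcsineDensity (ε / (4 * y)) / (4 * |y|)) =
      ENNReal.ofReal (1 / 2) * bandKernel (|ε| / 4) := by
    set φ : ℝ → ℝ≥0∞ := fun y =>
      ENNReal.ofReal (arcsineDensity y * arcsineDensity (ε / (4 * y)) / (4 * |y|)) with hφ
    have hpos : ∫⁻ y in Ioi 0, φ y = ENNReal.ofReal (1 / 4) * bandKernel (|ε| / 4) := by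
      rw [bandKernel, ← lintegral_const_mul' _ _ (by simp)]
      refine setLIntegral_congr_fun measurableSet_Ioi fun y hy => ?_
      have hy : 0 < y := hy
      simp only [hφ]
      rw [← ENNReal.ofReal_mul (by norm_num), abs_of_pos hy, ← arcsineDensity_abs (ε / (4 * y)),
        abs_div, abs_of_pos (by positivity : 0 < 4 * y), div_div]
      congr 1; field_simp
    have hneg : ∫⁻ y in Iio 0, φ y = ∫⁻ y in Ioi 0, φ y := by
      rw [setLIntegral_preimage_affine (c := -1) (by norm_num) 0 measurableSet_Iio]
      have h2 : (fun x : ℝ => -1 * x + 0) ⁻¹' Iio 0 = Ioi 0 := by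
        ext x; simp
      rw [h2]
      simp [hφ, arcsineDensity_neg, div_neg]
    have : ∫⁻ y, φ y = (∫⁻ y in Iio 0, φ y) + ∫⁻ y in Ioi 0, φ y := by
      rw [← setLIntegral_univ, ← Iio_union_Ici (a := (0 : ℝ)), lintegral_union measurableSet_Ici,
        setLIntegral_congr Ioi_ae_eq_Ici]
      exact Set.disjoint_left.2 fun x hx hx' => not_lt.2 (mem_Ici.1 hx') (mem_Iio.1 hx)
    rw [this, hneg, hpos, ← add_mul, ← ENNReal.ofReal_add (by norm_num) (by norm_num)]
    norm_num
  rw [e5]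
  have : ENNReal.ofReal (1 / (2 * π ^ 2)) =
      ENNReal.ofReal ((2 * π) ^ 2)⁻¹ * (2 * (2 * ENNReal.ofReal (1 / 2))) := by
    rw [← ENNReal.ofReal_ofNat 2, ← ENNReal.ofReal_mul (by norm_num),
      ← ENNReal.ofReal_mul (by norm_num), ← ENNReal.ofReal_mul (by positivity)]
    congr 1; field_simp
  rw [this]; ring

instance isProbabilityMeasure_momentumMeasure : IsProbabilityMeasure momentumMeasure := by
  constructor
  have h := lintegral_momentumMeasure (G := fun _ _ => 1) (by unfold Function.uncurry; fun_prop)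
  simp only [lintegral_const, one_mul, MeasurableSet.univ, Measure.restrict_apply, univ_inter,
    Real.volume_Ioc] at h
  rw [h, ← ENNReal.ofReal_mul (by linarith [pi_pos]), ← ENNReal.ofReal_mul (by positivity)]
  rw [← ENNReal.ofReal_one]; congr 1; field_simp; norm_num

theorem bandEnergyLaw_eq_withDensity : bandEnergyLaw 0 =
    volume.withDensity fun ε => ENNReal.ofReal (1 / (2 * π ^ 2)) * bandKernel (|ε| / 4) := by
  refine Measure.ext fun s hs => ?_
  rw [withDensity_apply _ hs, ← lintegral_indicator_one hs,
    lintegral_bandEnergyLaw (measurable_one.indicator hs), ← lintegral_indicator hs]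
  refine lintegral_congr fun ε => ?_
  by_cases h : ε ∈ s <;> simp [h]

/-! ### Decomposition of the elliptic integral -/

/-- For a nonnegative derivative integrability is automatic, and only continuity is needed at the
endpoints. This allows the inverse square-root singularity of the arcsine density at `1`. -/
theorem lintegral_deriv_of_nonneg {f f' : ℝ → ℝ} {a b : ℝ} (hab : a ≤ b)
    (hc : ContinuousOn f (Icc a b)) (hd : ∀ x ∈ Ioo a b, HasDerivAt f (f' x) x)
    (hn : ∀ x ∈ Ioo a b, 0 ≤ f' x) :
    ∫⁻ x in Ioo a b, ENNReal.ofReal (f' x) = ENNReal.ofReal (f b - f a) := by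
  have hi := intervalIntegral.integrableOn_deriv_of_nonneg hc hd hn
  rw [← intervalIntegral.integral_eq_sub_of_hasDerivAt_of_le hab hc hd
      ((intervalIntegrable_iff_integrableOn_Ioc_of_le hab).2 hi),
    intervalIntegral.integral_of_le hab, integral_Ioc_eq_integral_Ioo,
    ofReal_integral_eq_lintegral_ofReal (hi.mono_set Ioo_subset_Ioc_self)]
  exact (ae_restrict_mem measurableSet_Ioo).mono hn

/-- The part of the arcsine density that exceeds `1`. -/
def arcsineExcess (x : ℝ) : ℝ := max (arcsineDensity x - 1) 0

theorem arcsineExcess_nonneg (x : ℝ) : 0 ≤ arcsineExcess x := le_max_right _ _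

@[fun_prop]
theorem measurable_arcsineExcess : Measurable arcsineExcess := by
  unfold arcsineExcess; fun_prop

theorem arcsineExcess_of_one_le {x : ℝ} (hx : 1 ≤ x) : arcsineExcess x = 0 := by
  simp [arcsineExcess, arcsineDensity_of_one_le hx]

theorem sqrt_one_sub_sq_pos {x : ℝ} (hx : x ∈ Ioo 0 1) : 0 < √(1 - x ^ 2) :=
  Real.sqrt_pos.2 (by nlinarith [hx.1, hx.2])

theorem one_le_arcsineDensity {x : ℝ} (hx : x ∈ Ioo 0 1) : 1 ≤ arcsineDensity x := by
  refine (one_le_inv₀ (sqrt_one_sub_sq_pos hx)).2 ?_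
  exact Real.sqrt_le_one.2 (by nlinarith [hx.1])

theorem arcsineDensity_eq_one_add {x : ℝ} (hx : x ∈ Ioo 0 1) :
    arcsineDensity x = 1 + arcsineExcess x := by
  rw [arcsineExcess, max_eq_left (by linarith [one_le_arcsineDensity hx])]; ring

/-- With `w = √(1 - x²)` the claim for `x < 1` reads `1 - w ≤ 1 - w²`. It makes the convolution of
two excesses small of order `u²` relative to `K`. -/
theorem arcsineExcess_le {x : ℝ} (hx : 0 < x) :
    arcsineExcess x ≤ x ^ 2 * arcsineDensity x := by
  rcases lt_or_ge x 1 with h | h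
  · have hx' : x ∈ Ioo 0 1 := ⟨hx, h⟩
    have hw := sqrt_one_sub_sq_pos hx'
    have hs : √(1 - x ^ 2) ^ 2 = 1 - x ^ 2 := Real.sq_sqrt (by nlinarith)
    have := arcsineDensity_eq_one_add hx'
    have h1 : arcsineExcess x = arcsineDensity x - 1 := by linarith
    have h2 : √(1 - x ^ 2) ≤ 1 := Real.sqrt_le_one.2 (by nlinarith)
    rw [h1, arcsineDensity, ← div_eq_mul_inv, le_div_iff₀ hw, sub_mul, inv_mul_cancel₀ hw.ne']
    nlinarith
  · rw [arcsineExcess_of_one_le h, arcsineDensity_of_one_le h, mul_zero]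

/-- An explicit antiderivative of `e(x)/x`. It evaluates both cross terms in the splitting of `K`
and the total mass `log 2`. -/
theorem hasDerivAt_log_one_add_sqrt {x : ℝ} (hx : x ∈ Ioo 0 1) :
    HasDerivAt (fun x => log (1 + √(1 - x ^ 2))) (-(arcsineExcess x / x)) x := by
  have hw := sqrt_one_sub_sq_pos hx
  have hs : √(1 - x ^ 2) ^ 2 = 1 - x ^ 2 := Real.sq_sqrt (by nlinarith [hx.1, hx.2])
  have h0 : 1 - x ^ 2 ≠ 0 := by nlinarith [hx.1, hx.2]
  have h1 : HasDerivAt (fun x : ℝ => 1 - x ^ 2) (-(2 * x)) x := by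
    simpa using ((hasDerivAt_id x).pow 2).const_sub 1
  have h2 := ((h1.sqrt h0).const_add 1).log (by positivity)
  convert h2 using 1
  have h3 : arcsineExcess x = arcsineDensity x - 1 := by
    have := arcsineDensity_eq_one_add hx; linarith
  rw [h3, arcsineDensity]
  have hx0 := hx.1.ne'
  field_simp
  nlinarith

theorem continuous_log_one_add_sqrt : Continuous fun x : ℝ => log (1 + √(1 - x ^ 2)) := by
  refine Continuous.log (by fun_prop) fun x => ?_
  positivity

theorem lintegral_arcsineExcess_div {u : ℝ} (h0 : 0 ≤ u) (h1 : u ≤ 1) :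
    ∫⁻ x in Ioo u 1, ENNReal.ofReal (arcsineExcess x / x) =
      ENNReal.ofReal (log (1 + √(1 - u ^ 2))) := by
  rw [lintegral_deriv_of_nonneg (f := fun x => -log (1 + √(1 - x ^ 2))) h1
    continuous_log_one_add_sqrt.neg.continuousOn]
  · simp
  · intro x hx
    simpa using! (hasDerivAt_log_one_add_sqrt ⟨h0.trans_lt hx.1, hx.2⟩).neg
  · intro x hx
    exact div_nonneg (arcsineExcess_nonneg _) (h0.trans hx.1.le)

theorem setLIntegral_Ioi_eq_Ioo {F : ℝ → ℝ≥0∞} {u v : ℝ} (hu : 0 ≤ u)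
    (h : ∀ x, 0 < x → (x ≤ u ∨ v ≤ x) → F x = 0) :
    ∫⁻ x in Ioi 0, F x = ∫⁻ x in Ioo u v, F x := by
  rw [← lintegral_indicator measurableSet_Ioi, ← lintegral_indicator measurableSet_Ioo]
  refine lintegral_congr fun x => ?_
  by_cases hx : x ∈ Ioo u v
  · rw [indicator_of_mem hx, indicator_of_mem (mem_Ioi.2 (hu.trans_lt hx.1))]
  · rw [indicator_of_notMem hx]
    by_cases hx0 : 0 < x
    · rw [indicator_of_mem (mem_Ioi.2 hx0)]
      refine h x hx0 ?_
      by_contra hc; push Not at hc; exact hx hc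
    · rw [indicator_of_notMem (by simpa using hx0)]

theorem lintegral_arcsineExcess_div_Ioi :
    ∫⁻ x in Ioi 0, ENNReal.ofReal (arcsineExcess x / x) = ENNReal.ofReal (log 2) := by
  have := lintegral_arcsineExcess_div le_rfl zero_le_one
  norm_num at this
  rw [← this]
  refine setLIntegral_Ioi_eq_Ioo le_rfl fun x hx0 hx => ?_
  rw [arcsineExcess_of_one_le (hx.resolve_left hx0.not_ge), zero_div, ENNReal.ofReal_zero]

theorem lintegral_arcsineExcess_div_left {u : ℝ} (hu : u ∈ Ioo 0 1) :
    ∫⁻ x in Ioo u 1, ENNReal.ofReal (arcsineExcess (u / x) / x) =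
      ENNReal.ofReal (log (1 + √(1 - u ^ 2))) := by
  rw [lintegral_deriv_of_nonneg (f := fun x => log (1 + √(1 - (u / x) ^ 2))) hu.2.le]
  · simp [div_self hu.1.ne']
  · refine continuous_log_one_add_sqrt.comp_continuousOn
      (continuousOn_const.div continuousOn_id fun x hx => ?_)
    exact (hu.1.trans_le hx.1).ne'
  · intro x hx
    have hx0 : 0 < x := hu.1.trans hx.1
    have h1 : u / x ∈ Ioo 0 1 := ⟨div_pos hu.1 hx0, (div_lt_one hx0).2 hx.1⟩
    have h2 : HasDerivAt (fun x : ℝ => u / x) (-u / x ^ 2) x := by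
      simpa using! (hasDerivAt_const x u).div (hasDerivAt_id x) hx0.ne'
    refine (HasDerivAt.comp x (hasDerivAt_log_one_add_sqrt h1) h2).congr_deriv ?_
    have := hu.1.ne'
    have := hx0.ne'
    field_simp
  · intro x hx
    exact div_nonneg (arcsineExcess_nonneg _) (hu.1.trans hx.1).le

/-- The product part of the elliptic integral. -/
def excessConvolution (u : ℝ) : ℝ≥0∞ :=
  ∫⁻ x in Ioi 0, ENNReal.ofReal (arcsineExcess x * arcsineExcess (u / x) / x)

theorem measurable_excessConvolution : Measurable excessConvolution := by
  unfold excessConvolution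
  exact Measurable.lintegral_prod_right (f := fun u x : ℝ => ENNReal.ofReal
    (arcsineExcess x * arcsineExcess (u / x) / x)) (by fun_prop)

/-- On `u < x < 1` the integrand is `(1 + e(x)) (1 + e(u/x)) / x`. The constant term gives `log
(1/u)`, and the two cross terms are equal because `dx/x` is invariant under `x ↦ u/x`. -/
theorem bandKernel_eq {u : ℝ} (hu : u ∈ Ioo 0 1) : bandKernel u =
    ENNReal.ofReal (log (1 / u)) + 2 * ENNReal.ofReal (log (1 + √(1 - u ^ 2))) +
      excessConvolution u := by
  have h1 : bandKernel u =
      ∫⁻ x in Ioo u 1, ENNReal.ofReal (arcsineDensity x * arcsineDensity (u / x) / x) := by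
    refine setLIntegral_Ioi_eq_Ioo hu.1.le fun x hx0 hx => ?_
    rcases hx with hx | hx
    · rw [arcsineDensity_of_one_le (x := u / x) ((one_le_div hx0).2 hx)]; simp
    · rw [arcsineDensity_of_one_le hx]; simp
  have h2 : excessConvolution u =
      ∫⁻ x in Ioo u 1, ENNReal.ofReal (arcsineExcess x * arcsineExcess (u / x) / x) := by
    refine setLIntegral_Ioi_eq_Ioo hu.1.le fun x hx0 hx => ?_
    rcases hx with hx | hx
    · rw [arcsineExcess_of_one_le (x := u / x) ((one_le_div hx0).2 hx)]; simp
    · rw [arcsineExcess_of_one_le hx]; simp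
  have h3 : ∫⁻ x in Ioo u 1, ENNReal.ofReal (1 / x) = ENNReal.ofReal (log (1 / u)) := by
    rw [lintegral_deriv_of_nonneg (f := log) hu.2.le]
    · simp
    · exact continuousOn_log.mono fun x hx => (hu.1.trans_le hx.1).ne'
    · intro x hx; rw [one_div]; exact hasDerivAt_log (hu.1.trans hx.1).ne'
    · intro x hx; exact (one_div_pos.2 (hu.1.trans hx.1)).le
  rw [h1, h2, ← h3, two_mul]
  conv_rhs => enter [1, 2, 1]; rw [← lintegral_arcsineExcess_div hu.1.le hu.2.le]
  conv_rhs => enter [1, 2, 2]; rw [← lintegral_arcsineExcess_div_left hu]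
  rw [← lintegral_add_left (by fun_prop), ← lintegral_add_left (by fun_prop),
    ← lintegral_add_left (by fun_prop)]
  refine setLIntegral_congr_fun measurableSet_Ioo fun x hx => ?_
  have hx0 : 0 < x := hu.1.trans hx.1
  have e1 := arcsineExcess_nonneg x
  have e2 := arcsineExcess_nonneg (u / x)
  rw [← ENNReal.ofReal_add (by positivity) (by positivity),
    ← ENNReal.ofReal_add (by positivity) (by positivity),
    ← ENNReal.ofReal_add (by positivity) (by positivity),
    arcsineDensity_eq_one_add ⟨hx0, hx.2⟩,
    arcsineDensity_eq_one_add ⟨div_pos hu.1 hx0, (div_lt_one hx0).2 hx.1⟩]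
  congr 1; ring

/-- The two factors `x²` and `(u/x)²` multiply to `u²`, which leaves the integral. -/
theorem excessConvolution_le {u : ℝ} (hu : 0 < u) :
    excessConvolution u ≤ ENNReal.ofReal (u ^ 2) * bandKernel u := by
  rw [excessConvolution, bandKernel, ← lintegral_const_mul' _ _ ENNReal.ofReal_ne_top]
  refine setLIntegral_mono' measurableSet_Ioi fun x hx => ?_
  have hx : 0 < x := hx
  rw [← ENNReal.ofReal_mul (by positivity)]
  refine ENNReal.ofReal_le_ofReal ?_
  rw [← mul_div_assoc]
  refine div_le_div_of_nonneg_right ?_ hx.le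
  calc arcsineExcess x * arcsineExcess (u / x)
      ≤ (x ^ 2 * arcsineDensity x) * ((u / x) ^ 2 * arcsineDensity (u / x)) :=
        mul_le_mul (arcsineExcess_le hx) (arcsineExcess_le (div_pos hu hx))
          (arcsineExcess_nonneg _) (mul_nonneg (by positivity) (arcsineDensity_nonneg _))
    _ = u ^ 2 * (arcsineDensity x * arcsineDensity (u / x)) := by field_simp

/-- By Tonelli and the invariance of `du/u` under scaling, the integral of a multiplicative
convolution is the product of the integrals, here `(log 2)²`. -/
theorem lintegral_excessConvolution_div :
    ∫⁻ u in Ioi 0, excessConvolution u * ENNReal.ofReal (1 / u) = ENNReal.ofReal (log 2 ^ 2) := by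
  have h1 : ∀ u : ℝ, excessConvolution u * ENNReal.ofReal (1 / u) = ∫⁻ x in Ioi 0,
      ENNReal.ofReal (arcsineExcess x * arcsineExcess (u / x) / x) * ENNReal.ofReal (1 / u) := by
    intro u
    rw [excessConvolution, lintegral_mul_const' _ _ ENNReal.ofReal_ne_top]
  simp only [h1]
  rw [lintegral_lintegral_swap (by fun_prop)]
  have h2 : ∀ x ∈ Ioi (0 : ℝ), ∫⁻ u in Ioi 0,
      ENNReal.ofReal (arcsineExcess x * arcsineExcess (u / x) / x) * ENNReal.ofReal (1 / u) =
      ENNReal.ofReal (arcsineExcess x / x) * ENNReal.ofReal (log 2) := by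
    intro x hx
    have hx : 0 < x := hx
    rw [setLIntegral_preimage_affine hx.ne' 0 measurableSet_Ioi, ← lintegral_arcsineExcess_div_Ioi,
      ← lintegral_const_mul' _ _ ENNReal.ofReal_ne_top,
      ← lintegral_const_mul' _ _ ENNReal.ofReal_ne_top]
    have h3 : (fun y => x * y + 0) ⁻¹' Ioi 0 = Ioi 0 := by
      ext y; simp [hx]
    rw [h3]
    refine setLIntegral_congr_fun measurableSet_Ioi fun y hy => ?_
    have hy : 0 < y := hy
    have e1 := arcsineExcess_nonneg x
    have e2 := arcsineExcess_nonneg y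
    simp only [add_zero]
    rw [mul_div_cancel_left₀ _ hx.ne', ← ENNReal.ofReal_mul (by positivity),
      ← ENNReal.ofReal_mul (by positivity), ← ENNReal.ofReal_mul (by positivity), abs_of_pos hx]
    congr 1; field_simp
  rw [setLIntegral_congr_fun measurableSet_Ioi h2, lintegral_mul_const' _ _ ENNReal.ofReal_ne_top,
    lintegral_arcsineExcess_div_Ioi, ← ENNReal.ofReal_mul (log_nonneg one_le_two), sq]

theorem lintegral_bandEnergyLaw_abs {f : ℝ → ℝ≥0∞} (hf : Measurable f) :
    ∫⁻ ε, f |ε| ∂bandEnergyLaw 0 =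
      ENNReal.ofReal (4 / π ^ 2) * ∫⁻ u in Ioi 0, f (4 * u) * bandKernel u := by
  rw [lintegral_bandEnergyLaw (f := fun ε => f |ε|) (by fun_prop)]
  set φ : ℝ → ℝ≥0∞ := fun ε =>
    f |ε| * (ENNReal.ofReal (1 / (2 * π ^ 2)) * bandKernel (|ε| / 4)) with hφ
  have hpos : ∫⁻ ε in Ioi 0, φ ε =
      ENNReal.ofReal (2 / π ^ 2) * ∫⁻ u in Ioi 0, f (4 * u) * bandKernel u := by
    rw [setLIntegral_preimage_affine (c := 4) (by norm_num) 0 measurableSet_Ioi,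
      ← lintegral_const_mul' _ _ ENNReal.ofReal_ne_top,
      ← lintegral_const_mul' _ _ ENNReal.ofReal_ne_top]
    have h2 : (fun x : ℝ => 4 * x + 0) ⁻¹' Ioi 0 = Ioi 0 := by
      ext x; simp
    rw [h2]
    refine setLIntegral_congr_fun measurableSet_Ioi fun u hu => ?_
    have hu : 0 < u := hu
    have e : ENNReal.ofReal (2 / π ^ 2) =
        ENNReal.ofReal |4| * ENNReal.ofReal (1 / (2 * π ^ 2)) := by
      rw [← ENNReal.ofReal_mul (by positivity), abs_of_pos (by norm_num : (0 : ℝ) < 4)]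
      congr 1; field_simp; norm_num
    simp only [hφ, add_zero]
    rw [abs_of_pos (by positivity : 0 < 4 * u), mul_div_cancel_left₀ u (by norm_num : (4 : ℝ) ≠ 0),
      e]
    ring
  have hneg : ∫⁻ ε in Iio 0, φ ε = ∫⁻ ε in Ioi 0, φ ε := by
    rw [setLIntegral_preimage_affine (c := -1) (by norm_num) 0 measurableSet_Iio]
    have h2 : (fun x : ℝ => -1 * x + 0) ⁻¹' Iio 0 = Ioi 0 := by
      ext x; simp
    rw [h2]
    simp [hφ]
  have : ∫⁻ ε, φ ε = (∫⁻ ε in Iio 0, φ ε) + ∫⁻ ε in Ioi 0, φ ε := by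
    rw [← setLIntegral_univ, ← Iio_union_Ici (a := (0 : ℝ)), lintegral_union measurableSet_Ici,
      setLIntegral_congr Ioi_ae_eq_Ici]
    exact Set.disjoint_left.2 fun x hx hx' => not_lt.2 (mem_Ici.1 hx') (mem_Iio.1 hx)
  rw [this, hneg, hpos, ← add_mul, ← ENNReal.ofReal_add (by positivity) (by positivity)]
  congr 2; ring

/-- The band energy law has total mass 1. This gives the integrability of `K`, and its finiteness
almost everywhere, without estimating the elliptic integral. -/
theorem lintegral_bandKernel : ∫⁻ u in Ioi 0, bandKernel u = ENNReal.ofReal (π ^ 2 / 4) := by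
  have hband : Measurable (band 0) := by unfold band; fun_prop
  have h := lintegral_bandEnergyLaw_abs (f := fun _ => 1) measurable_const
  have h1 : IsProbabilityMeasure (bandEnergyLaw 0) :=
    Measure.isProbabilityMeasure_map hband.aemeasurable
  simp only [lintegral_const, measure_univ, one_mul] at h
  rw [show π ^ 2 / 4 = (4 / π ^ 2)⁻¹ by rw [inv_div], ENNReal.ofReal_inv_of_pos (by positivity)]
  exact (ENNReal.eq_inv_of_mul_eq_one_left (by rw [mul_comm]; exact h.symm))

/-! ### The logarithmic remainder of the elliptic integral -/

theorem hasSum_alternating_inv_sq :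
    HasSum (fun n : ℕ => (-1 : ℝ) ^ n / ((n : ℝ) + 1) ^ 2) (π ^ 2 / 12) := by
  have h1 : HasSum (fun n : ℕ => 1 / ((n : ℝ) + 1) ^ 2) (π ^ 2 / 6) := by
    have := (hasSum_nat_add_iff' (f := fun n : ℕ => 1 / (n : ℝ) ^ 2) 1).2 hasSum_zeta_two
    simpa using this
  have h2 : HasSum (fun n : ℕ => 1 / (((2 * n + 1 : ℕ) : ℝ) + 1) ^ 2) (π ^ 2 / 24) := by
    have h := h1.mul_left (1 / 4)
    rw [show 1 / 4 * (π ^ 2 / 6) = π ^ 2 / 24 by ring] at h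
    convert! h using 2 with n
    push_cast
    field_simp
    ring
  have h3 : HasSum (fun n : ℕ => 1 / (((2 * n : ℕ) : ℝ) + 1) ^ 2) (π ^ 2 / 8) := by
    have hs : Summable fun n : ℕ => 1 / (((2 * n : ℕ) : ℝ) + 1) ^ 2 :=
      h1.summable.comp_injective (i := fun n : ℕ => 2 * n) fun a b h => by simpa using h
    have h := (hs.hasSum.even_add_odd (f := fun n : ℕ => 1 / ((n : ℝ) + 1) ^ 2) h2).unique h1
    have : ∑' n : ℕ, 1 / (((2 * n : ℕ) : ℝ) + 1) ^ 2 = π ^ 2 / 8 := by linarith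
    rw [← this]; exact hs.hasSum
  have h4 : HasSum (fun n : ℕ => (-1 : ℝ) ^ (2 * n) / (((2 * n : ℕ) : ℝ) + 1) ^ 2) (π ^ 2 / 8) := by
    simpa [pow_mul] using h3
  have h5 : HasSum (fun n : ℕ => (-1 : ℝ) ^ (2 * n + 1) / (((2 * n + 1 : ℕ) : ℝ) + 1) ^ 2)
      (-(π ^ 2 / 24)) := by
    convert! h2.neg using 2 with n
    rw [pow_succ, pow_mul]
    simp [neg_div]
  have h := h4.even_add_odd (f := fun n : ℕ => (-1 : ℝ) ^ n / ((n : ℝ) + 1) ^ 2) h5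
  rwa [show π ^ 2 / 8 + -(π ^ 2 / 24) = π ^ 2 / 12 by ring] at h

/-- Termwise integration of the logarithm series leaves half of the alternating sum of inverse
squares. -/
theorem integral_log_one_add_sq_div :
    IntegrableOn (fun t : ℝ => log (1 + t ^ 2) / t) (Ioo 0 1) ∧
      ∫ t in Ioo (0 : ℝ) 1, log (1 + t ^ 2) / t = π ^ 2 / 24 := by
  set F : ℕ → ℝ → ℝ := fun n t => -((-t ^ 2) ^ (n + 1) / ((n : ℝ) + 1)) / t with hF
  have hF' : ∀ n, ∀ t ∈ Ioo (0 : ℝ) 1, F n t = (-1) ^ n / ((n : ℝ) + 1) * t ^ (2 * n + 1) := by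
    intro n t ht
    have := ht.1.ne'
    have hn : (n : ℝ) + 1 ≠ 0 := by positivity
    simp only [hF]
    rw [neg_pow]
    field_simp
    ring
  have hint : ∀ n : ℕ, ∫ t in Ioo (0 : ℝ) 1, t ^ (2 * n + 1) = 1 / (2 * ((n : ℝ) + 1)) := by
    intro n
    rw [← integral_Ioc_eq_integral_Ioo, ← intervalIntegral.integral_of_le zero_le_one, integral_pow]
    push_cast; simp; field_simp; ring
  have hi : ∀ n : ℕ, IntegrableOn (F n) (Ioo 0 1) := by
    intro n
    refine IntegrableOn.congr_fun (f := fun t => (-1) ^ n / ((n : ℝ) + 1) * t ^ (2 * n + 1)) ?_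
      (fun t ht => (hF' n t ht).symm) measurableSet_Ioo
    exact (Continuous.integrableOn_Icc (by fun_prop)).mono_set Ioo_subset_Icc_self
  have hval : ∀ n, ∫ t in Ioo (0 : ℝ) 1, F n t = (-1) ^ n / ((n : ℝ) + 1) ^ 2 / 2 := by
    intro n
    rw [setIntegral_congr_fun measurableSet_Ioo (hF' n), integral_const_mul, hint]
    field_simp
  have hnorm : ∀ n, ∫ t in Ioo (0 : ℝ) 1, ‖F n t‖ = 1 / ((n : ℝ) + 1) ^ 2 / 2 := by
    intro n
    have : ∀ t ∈ Ioo (0 : ℝ) 1, ‖F n t‖ = 1 / ((n : ℝ) + 1) * t ^ (2 * n + 1) := by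
      intro t ht
      have hn : (0 : ℝ) < (n : ℝ) + 1 := by positivity
      rw [hF' n t ht, norm_mul, norm_div, norm_pow, norm_neg, norm_one, one_pow, norm_pow,
        Real.norm_of_nonneg ht.1.le, Real.norm_of_nonneg hn.le]
    rw [setIntegral_congr_fun measurableSet_Ioo this, integral_const_mul, hint]
    field_simp
  have hsum : Summable fun n : ℕ => 1 / ((n : ℝ) + 1) ^ 2 := by
    have := (hasSum_nat_add_iff' (f := fun n : ℕ => 1 / (n : ℝ) ^ 2) 1).2 hasSum_zeta_two
    simpa using this.summable
  have hs : Summable fun n => ∫ t in Ioo (0 : ℝ) 1, ‖F n t‖ := by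
    simp only [hnorm]; exact hsum.div_const 2
  have hlog : ∀ t ∈ Ioo (0 : ℝ) 1, HasSum (fun n => F n t) (log (1 + t ^ 2) / t) := by
    intro t ht
    have h1 : |-t ^ 2| < 1 := by
      rw [abs_neg, abs_of_nonneg (by positivity)]; nlinarith [ht.1, ht.2]
    have := ((hasSum_pow_div_log_of_abs_lt_one h1).neg).div_const t
    simpa using this
  have hmain := hasSum_integral_of_summable_integral_norm hi hs
  have hcongr : ∀ t ∈ Ioo (0 : ℝ) 1, ∑' n, F n t = log (1 + t ^ 2) / t :=
    fun t ht => (hlog t ht).tsum_eq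
  rw [setIntegral_congr_fun measurableSet_Ioo hcongr] at hmain
  simp only [hval] at hmain
  refine ⟨?_, ?_⟩
  · have hb : ∀ t ∈ Ioo (0 : ℝ) 1, ‖log (1 + t ^ 2) / t‖ ≤ 1 := by
      intro t ht
      have h0 : 0 ≤ log (1 + t ^ 2) := log_nonneg (by nlinarith [ht.1])
      have h1 : log (1 + t ^ 2) ≤ t ^ 2 := by
        have := log_le_sub_one_of_pos (by positivity : 0 < 1 + t ^ 2); linarith
      rw [Real.norm_of_nonneg (div_nonneg h0 ht.1.le), div_le_one ht.1]
      nlinarith [ht.1, ht.2]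
    refine IntegrableOn.of_bound (by simp) ?_ 1 ((ae_restrict_mem measurableSet_Ioo).mono hb)
    exact Measurable.aestronglyMeasurable (by fun_prop)
  · rw [hmain.unique (hasSum_alternating_inv_sq.div_const 2)]; ring

/-- The substitution `u = 2t/(1 + t²)` rationalizes the root: `(1 + √(1 - u²))/2 = 1/(1 + t²)` and
`du/u = (1/t - 2t/(1 + t²)) dt`. One part is the preceding logarithmic integral, the other is the
exact derivative of `log² (1 + t²)`. -/
theorem integral_log_sqrt_div :
    IntegrableOn (fun u : ℝ => 2 * log ((1 + √(1 - u ^ 2)) / 2) / u) (Ioo 0 1) ∧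
      ∫ u in Ioo (0 : ℝ) 1, 2 * log ((1 + √(1 - u ^ 2)) / 2) / u = log 2 ^ 2 - π ^ 2 / 12 := by
  set φ : ℝ → ℝ := fun t => 2 * t / (1 + t ^ 2) with hφ
  have hd : ∀ t ∈ Ioo (0 : ℝ) 1,
      HasDerivWithinAt φ (2 * (1 - t ^ 2) / (1 + t ^ 2) ^ 2) (Ioo 0 1) t := by
    intro t _
    have h1 : HasDerivAt (fun t : ℝ => 1 + t ^ 2) (2 * t) t := by
      simpa using ((hasDerivAt_id t).pow 2).const_add 1
    have h2 : HasDerivAt (fun t : ℝ => 2 * t) 2 t := by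
      simpa using (hasDerivAt_id t).const_mul 2
    refine ((h2.div h1 (by positivity)).congr_deriv ?_).hasDerivWithinAt
    congr 1; ring
  have hlt : ∀ s t : ℝ, 0 < s → s < t → t < 1 → φ s < φ t := by
    intro s t hs hst ht
    simp only [hφ]
    rw [div_lt_div_iff₀ (by positivity) (by positivity)]
    have : 0 < 1 - s * t := by nlinarith
    nlinarith [mul_pos (sub_pos.2 hst) this]
  have hinj : InjOn φ (Ioo 0 1) := by
    refine StrictMonoOn.injOn fun s hs t ht hst => hlt s t hs.1 hst ht.2
  have hw : ∀ t ∈ Ioo (0 : ℝ) 1, √(1 - φ t ^ 2) = (1 - t ^ 2) / (1 + t ^ 2) := by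
    intro t ht
    have h0 : 0 ≤ (1 - t ^ 2) / (1 + t ^ 2) := div_nonneg (by nlinarith [ht.1, ht.2]) (by positivity)
    rw [← Real.sqrt_sq h0]
    congr 1
    simp only [hφ]; field_simp; ring
  have himg : φ '' Ioo 0 1 = Ioo 0 1 := by
    ext u; constructor
    · rintro ⟨t, ht, rfl⟩
      have := ht.1
      refine ⟨by simp only [hφ]; positivity, ?_⟩
      simp only [hφ]
      rw [div_lt_one (by positivity)]; nlinarith [ht.2, sq_nonneg (1 - t), mul_pos (sub_pos.2 ht.2) (sub_pos.2 ht.2)]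
    · intro hu
      have hs := sqrt_one_sub_sq_pos hu
      have hs2 : √(1 - u ^ 2) ^ 2 = 1 - u ^ 2 := Real.sq_sqrt (by nlinarith [hu.1, hu.2])
      set w := √(1 - u ^ 2)
      have hu0 := hu.1
      refine ⟨u / (1 + w), ⟨by positivity, ?_⟩, ?_⟩
      · rw [div_lt_one (by positivity)]; linarith [hu.2]
      · simp only [hφ]
        have : (1 + w) ^ 2 + u ^ 2 = 2 * (1 + w) := by nlinarith
        have h2 : (1 + (u / (1 + w)) ^ 2) = 2 / (1 + w) := by
          field_simp; linarith
        rw [h2]; field_simp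
  have hcomp : ∀ t ∈ Ioo (0 : ℝ) 1, |2 * (1 - t ^ 2) / (1 + t ^ 2) ^ 2| •
      (2 * log ((1 + √(1 - φ t ^ 2)) / 2) / φ t) =
      -2 * (log (1 + t ^ 2) / t) + 4 * t * log (1 + t ^ 2) / (1 + t ^ 2) := by
    intro t ht
    have h0 : 0 ≤ 2 * (1 - t ^ 2) / (1 + t ^ 2) ^ 2 :=
      div_nonneg (by nlinarith [ht.1, ht.2]) (by positivity)
    have h1 : (1 + (1 - t ^ 2) / (1 + t ^ 2)) / 2 = (1 + t ^ 2)⁻¹ := by field_simp; ring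
    have ht0 := ht.1.ne'
    rw [hw t ht, abs_of_nonneg h0, h1, log_inv, smul_eq_mul]
    simp only [hφ]
    field_simp
    ring
  have hc : Continuous fun t : ℝ => 4 * t * log (1 + t ^ 2) / (1 + t ^ 2) := by
    refine Continuous.div (Continuous.mul (by fun_prop) (Continuous.log (by fun_prop) ?_))
      (by fun_prop) ?_ <;> intro t <;> positivity
  have hci : IntegrableOn (fun t : ℝ => 4 * t * log (1 + t ^ 2) / (1 + t ^ 2)) (Ioo 0 1) :=
    hc.integrableOn_Icc.mono_set Ioo_subset_Icc_self
  have hcv : ∫ t in Ioo (0 : ℝ) 1, 4 * t * log (1 + t ^ 2) / (1 + t ^ 2) = log 2 ^ 2 := by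
    rw [← integral_Ioc_eq_integral_Ioo, ← intervalIntegral.integral_of_le zero_le_one,
      intervalIntegral.integral_eq_sub_of_hasDerivAt (f := fun t => log (1 + t ^ 2) ^ 2)]
    · norm_num
    · intro t _
      have h1 : HasDerivAt (fun t : ℝ => 1 + t ^ 2) (2 * t) t := by
        simpa using ((hasDerivAt_id t).pow 2).const_add 1
      refine ((h1.log (by positivity)).pow 2).congr_deriv ?_
      simp; ring
    · exact hc.intervalIntegrable _ _
  obtain ⟨hi, hv⟩ := integral_log_one_add_sq_div
  constructor
  · rw [← himg, integrableOn_image_iff_integrableOn_abs_deriv_smul measurableSet_Ioo hd hinj]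
    exact IntegrableOn.congr_fun ((hi.const_mul (-2)).add hci) (fun t ht => (hcomp t ht).symm) measurableSet_Ioo
  · conv_lhs => rw [← himg]
    rw [integral_image_eq_integral_abs_deriv_smul measurableSet_Ioo hd hinj,
      setIntegral_congr_fun measurableSet_Ioo hcomp, integral_add (hi.const_mul (-2)) hci,
      integral_const_mul, hv, hcv]
    ring

/-! ### The remainder as a real function, and the density of states -/

theorem bandKernel_of_one_le {u : ℝ} (hu : 1 ≤ u) : bandKernel u = 0 := by
  have h := setLIntegral_Ioi_eq_Ioo (u := 1) (v := 1) zero_le_one (F := fun x => ENNReal.ofReal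
    (arcsineDensity x * arcsineDensity (u / x) / x)) fun x hx0 hx => by
      rcases hx with hx | hx
      · rw [arcsineDensity_of_one_le (x := u / x) ((one_le_div hx0).2 (hx.trans hu))]; simp
      · rw [arcsineDensity_of_one_le hx]; simp
  rw [bandKernel, h]; simp

/-- The real value of the complete elliptic integral. -/
def ellipticK (u : ℝ) : ℝ := (bandKernel u).toReal

theorem ellipticK_nonneg (u : ℝ) : 0 ≤ ellipticK u := ENNReal.toReal_nonneg

@[fun_prop]
theorem measurable_ellipticK : Measurable ellipticK := measurable_bandKernel.ennreal_toReal

theorem ae_bandKernel_lt_top : ∀ᵐ u ∂volume.restrict (Ioi (0 : ℝ)), bandKernel u < ⊤ :=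
  ae_lt_top measurable_bandKernel (by rw [lintegral_bandKernel]; exact ENNReal.ofReal_ne_top)

theorem integrableOn_ellipticK_Ioi : IntegrableOn ellipticK (Ioi 0) :=
  integrable_toReal_of_lintegral_ne_top measurable_bandKernel.aemeasurable
    (by rw [lintegral_bandKernel]; exact ENNReal.ofReal_ne_top)

theorem integrableOn_ellipticK : IntegrableOn ellipticK (Ioo 0 1) :=
  integrableOn_ellipticK_Ioi.mono_set Ioo_subset_Ioi_self

/-- The difference of the elliptic integral and its logarithmic singularity. -/
def logRemainder (u : ℝ) : ℝ := ellipticK u - log (4 / u)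

@[fun_prop]
theorem measurable_logRemainder : Measurable logRemainder := by
  unfold logRemainder; fun_prop

/-- Since `log 4 = 2 log 2`, subtracting `log (4/u)` halves the argument of each elementary
logarithm. The statement is almost everywhere because `K` is only known to be finite there. -/
theorem ae_logRemainder_eq : ∀ᵐ u ∂volume.restrict (Ioo (0 : ℝ) 1),
    logRemainder u = 2 * log ((1 + √(1 - u ^ 2)) / 2) + (excessConvolution u).toReal ∧
      (excessConvolution u).toReal ≤ u ^ 2 * ellipticK u := by
  have h0 := ae_restrict_of_ae_restrict_of_subset (fun x (hx : x ∈ Ioo (0 : ℝ) 1) => mem_Ioi.2 hx.1)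
    ae_bandKernel_lt_top
  filter_upwards [h0, ae_restrict_mem measurableSet_Ioo] with u hK hu
  have hQ := excessConvolution_le hu.1
  have hQt : excessConvolution u ≠ ⊤ :=
    (hQ.trans_lt (ENNReal.mul_lt_top ENNReal.ofReal_lt_top hK)).ne
  constructor
  · have h1 : 0 ≤ log (1 / u) := log_nonneg (by rw [le_div_iff₀ hu.1]; linarith [hu.2])
    have h2 : 0 ≤ log (1 + √(1 - u ^ 2)) := log_nonneg (by linarith [sqrt_nonneg (1 - u ^ 2)])
    have hu0 := hu.1.ne'
    rw [logRemainder, ellipticK, bandKernel_eq hu, ENNReal.toReal_add _ hQt, ENNReal.toReal_add,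
      ENNReal.toReal_mul, ENNReal.toReal_ofReal h1, ENNReal.toReal_ofReal h2,
      log_div (by positivity) two_ne_zero, log_div one_ne_zero hu0, log_div four_ne_zero hu0,
      show (4 : ℝ) = 2 ^ 2 by norm_num, log_pow]
    · simp; ring
    · exact ENNReal.ofReal_ne_top
    · exact ENNReal.mul_ne_top (by simp) ENNReal.ofReal_ne_top
    · exact ENNReal.add_ne_top.2 ⟨ENNReal.ofReal_ne_top,
        ENNReal.mul_ne_top (by simp) ENNReal.ofReal_ne_top⟩
  · have := ENNReal.toReal_mono (ENNReal.mul_ne_top ENNReal.ofReal_ne_top hK.ne) hQ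
    rwa [ENNReal.toReal_mul, ENNReal.toReal_ofReal (by positivity)] at this

theorem two_mul_log_half_bounds {u : ℝ} (hu : u ∈ Ioo 0 1) :
    -(2 * u ^ 2) ≤ 2 * log ((1 + √(1 - u ^ 2)) / 2) ∧
      2 * log ((1 + √(1 - u ^ 2)) / 2) ≤ 0 := by
  have hs := sqrt_one_sub_sq_pos hu
  have hs2 : √(1 - u ^ 2) ^ 2 = 1 - u ^ 2 := Real.sq_sqrt (by nlinarith [hu.1, hu.2])
  have hs1 : √(1 - u ^ 2) ≤ 1 := Real.sqrt_le_one.2 (by nlinarith [hu.1])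
  set w := √(1 - u ^ 2)
  constructor
  · have h := one_sub_inv_le_log_of_pos (by positivity : 0 < (1 + w) / 2)
    have h2 : -u ^ 2 ≤ 1 - ((1 + w) / 2)⁻¹ := by
      rw [inv_div, le_sub_iff_add_le, add_comm, ← le_sub_iff_add_le, div_le_iff₀ (by positivity)]
      nlinarith
    linarith
  · have := log_nonpos (by positivity) (by linarith : (1 + w) / 2 ≤ 1)
    linarith

theorem ae_abs_logRemainder_le : ∀ᵐ u ∂volume.restrict (Ioo (0 : ℝ) 1),
    |logRemainder u| ≤ u ^ 2 * (2 + ellipticK u) := by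
  filter_upwards [ae_logRemainder_eq, ae_restrict_mem measurableSet_Ioo] with u ⟨h1, h2⟩ hu
  obtain ⟨h3, h4⟩ := two_mul_log_half_bounds hu
  have h5 : 0 ≤ (excessConvolution u).toReal := ENNReal.toReal_nonneg
  have h6 : 0 ≤ u ^ 2 * ellipticK u := by have := ellipticK_nonneg u; positivity
  rw [h1, abs_le]
  constructor <;> nlinarith

/-- The bound `R ≤ u² K ≤ K/2` is absorbed into the left side of `K = log (4/u) + R`. -/
theorem ae_ellipticK_le : ∀ᵐ u ∂volume.restrict (Ioo (0 : ℝ) 1),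
    u ≤ 1 / 2 → ellipticK u ≤ 2 * log (4 / u) := by
  filter_upwards [ae_logRemainder_eq, ae_restrict_mem measurableSet_Ioo] with u ⟨h1, h2⟩ hu hu2
  obtain ⟨h3, h4⟩ := two_mul_log_half_bounds hu
  have h5 := ellipticK_nonneg u
  rw [logRemainder] at h1
  have h6 : u ^ 2 ≤ 1 / 2 := by nlinarith [hu.1]
  nlinarith

theorem integrableOn_logRemainder_div :
    IntegrableOn (fun u => logRemainder u / u) (Ioo 0 1) := by
  refine Integrable.mono' (g := fun u => 2 + ellipticK u)
    ((integrable_const 2).add integrableOn_ellipticK)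
    (Measurable.aestronglyMeasurable (by fun_prop)) ?_
  filter_upwards [ae_abs_logRemainder_le, ae_restrict_mem measurableSet_Ioo] with u h hu
  have h5 := ellipticK_nonneg u
  rw [Real.norm_eq_abs, abs_div, abs_of_pos hu.1, div_le_iff₀ hu.1]
  nlinarith [hu.1, hu.2, mul_nonneg (mul_nonneg (sub_nonneg.2 hu.2.le) hu.1.le) (by linarith : 0 ≤ 2 + ellipticK u)]

/-- The elementary logarithm contributes `log² 2 - π²/12` and the convolution of excesses
contributes `log² 2`. -/
theorem integral_logRemainder_div :
    ∫ u in Ioo 0 1, logRemainder u / u = 2 * log 2 ^ 2 - π ^ 2 / 12 := by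
  obtain ⟨hi, hv⟩ := integral_log_sqrt_div
  have hmeas : Measurable fun u : ℝ => excessConvolution u * ENNReal.ofReal (1 / u) :=
    measurable_excessConvolution.mul (by fun_prop)
  have hz : ∫⁻ u in Ioo 0 1, excessConvolution u * ENNReal.ofReal (1 / u) =
      ENNReal.ofReal (log 2 ^ 2) := by
    rw [← lintegral_excessConvolution_div]
    refine (setLIntegral_Ioi_eq_Ioo le_rfl fun u hu0 hu => ?_).symm
    have h := setLIntegral_Ioi_eq_Ioo (u := 1) (v := 1) zero_le_one (F := fun x => ENNReal.ofReal
      (arcsineExcess x * arcsineExcess (u / x) / x)) fun x hx0 hx => by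
        rcases hx with hx | hx
        · rw [arcsineExcess_of_one_le (x := u / x)
            ((one_le_div hx0).2 (hx.trans (hu.resolve_left hu0.not_ge)))]; simp
        · rw [arcsineExcess_of_one_le hx]; simp
    rw [excessConvolution, h]; simp
  have hQi : IntegrableOn (fun u => (excessConvolution u).toReal / u) (Ioo 0 1) := by
    refine IntegrableOn.congr_fun (integrable_toReal_of_lintegral_ne_top hmeas.aemeasurable
      (by rw [hz]; exact ENNReal.ofReal_ne_top)) (fun u hu => ?_) measurableSet_Ioo
    rw [ENNReal.toReal_mul, ENNReal.toReal_ofReal (one_div_pos.2 hu.1).le, mul_one_div]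
  have hQv : ∫ u in Ioo 0 1, (excessConvolution u).toReal / u = log 2 ^ 2 := by
    have h1 : ∀ u ∈ Ioo (0 : ℝ) 1, (excessConvolution u).toReal / u =
        (excessConvolution u * ENNReal.ofReal (1 / u)).toReal := by
      intro u hu
      rw [ENNReal.toReal_mul, ENNReal.toReal_ofReal (one_div_pos.2 hu.1).le, mul_one_div]
    rw [setIntegral_congr_fun measurableSet_Ioo h1, integral_toReal hmeas.aemeasurable, hz,
      ENNReal.toReal_ofReal (by positivity)]
    exact ae_lt_top hmeas (by rw [hz]; exact ENNReal.ofReal_ne_top)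
  have h : ∀ᵐ u ∂volume.restrict (Ioo (0 : ℝ) 1), logRemainder u / u =
      2 * log ((1 + √(1 - u ^ 2)) / 2) / u + (excessConvolution u).toReal / u := by
    filter_upwards [ae_logRemainder_eq] with u hu
    rw [hu.1, add_div]
  rw [integral_congr_ae h, integral_add hi hQi, hv, hQv]
  ring

/-- A Radon–Nikodym derivative is determined only up to null sets, so every use of `N_0` passes
through this almost-everywhere identity. -/
theorem densityOfStates_ae_eq :
    ∀ᵐ ε : ℝ, densityOfStates 0 ε = 1 / (2 * π ^ 2) * ellipticK (|ε| / 4) := by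
  have hm : Measurable fun ε : ℝ => ENNReal.ofReal (1 / (2 * π ^ 2)) * bandKernel (|ε| / 4) :=
    (measurable_bandKernel.comp (by fun_prop : Measurable fun ε : ℝ => |ε| / 4)).const_mul _
  have h := Measure.rnDeriv_withDensity volume hm
  rw [← bandEnergyLaw_eq_withDensity] at h
  filter_upwards [h] with ε hε
  rw [densityOfStates, hε, ENNReal.toReal_mul, ENNReal.toReal_ofReal (by positivity), ellipticK]

theorem bandEnergyLaw_eq_withDensity_densityOfStates : bandEnergyLaw 0 =
    volume.withDensity (fun ε => ENNReal.ofReal (densityOfStates 0 ε)) := by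
  have hband : Measurable (band 0) := by unfold band; fun_prop
  have : IsProbabilityMeasure (bandEnergyLaw 0) :=
    Measure.isProbabilityMeasure_map hband.aemeasurable
  have hac : bandEnergyLaw 0 ≪ volume := by
    rw [bandEnergyLaw_eq_withDensity]; exact withDensity_absolutelyContinuous _ _
  conv_lhs => rw [← Measure.withDensity_rnDeriv_eq _ _ hac]
  refine withDensity_congr_ae ?_
  filter_upwards [Measure.rnDeriv_lt_top (bandEnergyLaw 0) volume] with ε hε
  rw [densityOfStates, ENNReal.ofReal_toReal hε.ne]

theorem densityRemainder_ae_eq : ∀ᵐ ε ∂volume.restrict (Ioc (0 : ℝ) 4),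
    1 / (8 * π ^ 2) * (logRemainder (ε / 4) / (ε / 4)) = densityRemainder ε := by
  filter_upwards [ae_restrict_of_ae densityOfStates_ae_eq, ae_restrict_mem measurableSet_Ioc]
    with ε h hε
  have h0 := hε.1.ne'
  rw [densityRemainder, h, abs_of_pos hε.1, logRemainder,
    show 4 / (ε / 4) = 16 / ε by field_simp; norm_num]
  field_simp
  ring

theorem intervalIntegrable_densityRemainder :
    IntervalIntegrable densityRemainder volume 0 4 := by
  have h1 : IntervalIntegrable (fun u => logRemainder u / u) volume 0 1 := by
    rw [intervalIntegrable_iff_integrableOn_Ioo_of_le zero_le_one]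
    exact integrableOn_logRemainder_div
  have h2 := (h1.comp_mul_right (c := 1 / 4)).const_mul (1 / (8 * π ^ 2))
  norm_num at h2
  rw [intervalIntegrable_iff_integrableOn_Ioc_of_le (by norm_num)] at h2 ⊢
  refine Integrable.congr h2 ?_
  filter_upwards [densityRemainder_ae_eq] with ε h
  rw [← h]; simp [div_eq_mul_inv]

theorem integral_densityRemainder :
    ∫ ε in (0 : ℝ)..4, densityRemainder ε =
      1 / (2 * π ^ 2) * (2 * log 2 ^ 2 - π ^ 2 / 12) := by
  rw [intervalIntegral.integral_of_le (by norm_num), ← integral_congr_ae densityRemainder_ae_eq,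
    ← intervalIntegral.integral_of_le (by norm_num), intervalIntegral.integral_const_mul,
    intervalIntegral.integral_comp_div (fun u => logRemainder u / u) (by norm_num : (4 : ℝ) ≠ 0),
    zero_div, div_self (by norm_num), intervalIntegral.integral_of_le zero_le_one,
    integral_Ioc_eq_integral_Ioo, integral_logRemainder_div, smul_eq_mul]
  field_simp
  ring

/-! ### Logarithmic moments of the exponential distribution -/

/-- Each derivative in `s` of the Mellin transform of `e^(-t)` brings in a factor `log t`.
Logarithmic moments thereby become derivatives of the Gamma function. -/
theorem hasDerivAt_mellin_log_exp {s : ℂ} (hs : 0 < s.re) :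
    MellinConvergent (fun t : ℝ => log t • (Real.exp (-t) : ℂ)) s ∧
    HasDerivAt (mellin fun t : ℝ => (Real.exp (-t) : ℂ))
      (mellin (fun t : ℝ => log t • (Real.exp (-t) : ℂ)) s) s ∧
    MellinConvergent (fun t : ℝ => log t • log t • (Real.exp (-t) : ℂ)) s ∧
    HasDerivAt (mellin fun t : ℝ => log t • (Real.exp (-t) : ℂ))
      (mellin (fun t : ℝ => log t • log t • (Real.exp (-t) : ℂ)) s) s := by
  have hc : Continuous fun t : ℝ => (Real.exp (-t) : ℂ) := by fun_prop
  have htop : ∀ a : ℝ, (fun t : ℝ => (Real.exp (-t) : ℂ)) =O[atTop] (· ^ (-a)) := by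
    intro a
    rw [← isBigO_norm_left]
    simp_rw [Complex.norm_real, isBigO_norm_left]
    simpa only [neg_one_mul] using (isLittleO_exp_neg_mul_rpow_atTop zero_lt_one _).isBigO
  have hbot : (fun t : ℝ => (Real.exp (-t) : ℂ)) =O[𝓝[>] 0] (· ^ (-(0 : ℝ))) := by
    simp_rw [neg_zero, rpow_zero]
    refine isBigO_const_of_tendsto (?_ : Tendsto _ _ (𝓝 (1 : ℂ))) one_ne_zero
    rw [(by simp : (1 : ℂ) = Real.exp (-0))]
    exact hc.continuousWithinAt
  have hlc : LocallyIntegrableOn (fun t : ℝ => log t • (Real.exp (-t) : ℂ)) (Ioi 0) := by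
    refine ContinuousOn.locallyIntegrableOn ?_ measurableSet_Ioi
    exact (continuousOn_log.mono fun x (hx : 0 < x) => hx.ne').smul hc.continuousOn
  have h1 := mellin_hasDerivAt_of_isBigO_rpow
    (hc.continuousOn.locallyIntegrableOn measurableSet_Ioi) (htop (s.re + 1)) (lt_add_one _) hbot hs
  have h2 := mellin_hasDerivAt_of_isBigO_rpow hlc
    (isBigO_rpow_top_log_smul (by linarith : s.re + 1 < s.re + 2) (htop (s.re + 2))) (lt_add_one _)
    (isBigO_rpow_zero_log_smul (half_pos hs) hbot) (half_lt_self hs)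
  exact ⟨h1.1, h1.2, h2.1, h2.2⟩

theorem tendsto_self_sub_sin_div_cube :
    Tendsto (fun y : ℝ => (y - sin y) / y ^ 3) (𝓝[≠] 0) (𝓝 (1 / 6)) := by
  rw [tendsto_iff_dist_tendsto_zero]
  refine squeeze_zero' (Eventually.of_forall fun _ => dist_nonneg)
    (g := fun y => |y| ^ 2 * (1 / 100)) ?_ ?_
  · have h1 : ∀ᶠ y : ℝ in 𝓝[≠] 0, |y| ≤ 1 := by
      refine nhdsWithin_le_nhds ?_
      have : ContinuousAt (fun y : ℝ => |y|) 0 := by fun_prop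
      exact (this.eventually (gt_mem_nhds (by simp : |(0 : ℝ)| < 1))).mono fun y hy => hy.le
    filter_upwards [h1, self_mem_nhdsWithin] with y hy hy0
    have hy0 : y ≠ 0 := hy0
    have h := Real.sin_bound hy
    rw [Real.dist_eq]
    have e : (y - sin y) / y ^ 3 - 1 / 6 = -(sin y - (y - y ^ 3 / 6)) / y ^ 3 := by
      field_simp; ring
    rw [e, abs_div, abs_neg, abs_pow, div_le_iff₀ (by positivity)]
    calc _ ≤ _ := h
      _ = _ := by ring
  · have : ContinuousAt (fun y : ℝ => |y| ^ 2 * (1 / 100)) 0 := by fun_prop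
    have h := this.tendsto.mono_left (nhdsWithin_le_nhds (s := {0}ᶜ))
    simpa using h

theorem integral_log_mul_exp_neg :
    IntegrableOn (fun t : ℝ => log t * exp (-t)) (Ioi 0) ∧
      ∫ t in Ioi (0 : ℝ), log t * exp (-t) = -eulerMascheroniConstant := by
  obtain ⟨h1, h2, -, -⟩ := hasDerivAt_mellin_log_exp (s := 1) (by simp)
  have e : ∀ t : ℝ, (t : ℂ) ^ ((1 : ℂ) - 1) • (log t • (Real.exp (-t) : ℂ)) =
      ((log t * exp (-t) : ℝ) : ℂ) := by intro t; simp
  constructor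
  · have := h1
    rw [MellinConvergent] at this
    simp only [e] at this
    simpa only [RCLike.re_to_complex, Complex.ofReal_re] using! this.re
  · rw [mellin] at h2
    simp only [e] at h2
    rw [integral_complex_ofReal, ← Complex.GammaIntegral_eq_mellin] at h2
    have h3 : HasDerivAt Complex.GammaIntegral (-(eulerMascheroniConstant : ℂ)) 1 := by
      refine Complex.hasDerivAt_Gamma_one.congr_of_eventuallyEq ?_
      have : {s : ℂ | 0 < s.re} ∈ 𝓝 (1 : ℂ) :=
        (isOpen_lt continuous_const Complex.continuous_re).mem_nhds (by simp)
      filter_upwards [this] with s hs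
      exact (Complex.Gamma_eq_integral hs).symm
    exact_mod_cast h2.unique h3

/-- The second moment is `Γ''(1)`. By the reflection formula `Γ(1+x) Γ(1-x) = πx / sin πx`, and
comparing the coefficients of `x²` gives `Γ''(1) - γ² = π²/6`. -/
theorem integral_log_sq_mul_exp_neg :
    IntegrableOn (fun t : ℝ => log t ^ 2 * exp (-t)) (Ioi 0) ∧
      ∫ t in Ioi (0 : ℝ), log t ^ 2 * exp (-t) = eulerMascheroniConstant ^ 2 + π ^ 2 / 6 := by
  set M : ℂ → ℂ := mellin (fun t : ℝ => log t • (Real.exp (-t) : ℂ)) with hM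
  obtain ⟨h1, h2, h3, h4⟩ := hasDerivAt_mellin_log_exp (s := 1) (by simp)
  have e : ∀ t : ℝ, (t : ℂ) ^ ((1 : ℂ) - 1) • (log t • log t • (Real.exp (-t) : ℂ)) =
      ((log t ^ 2 * exp (-t) : ℝ) : ℂ) := by intro t; simp; ring
  have e1 : ∀ t : ℝ, (t : ℂ) ^ ((1 : ℂ) - 1) • (log t • (Real.exp (-t) : ℂ)) =
      ((log t * exp (-t) : ℝ) : ℂ) := by intro t; simp
  constructor
  · have := h3
    rw [MellinConvergent] at this
    simp only [e] at this
    simpa only [RCLike.re_to_complex, Complex.ofReal_re] using! this.re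
  set V := ∫ t in Ioi (0 : ℝ), log t ^ 2 * exp (-t) with hV
  have hD1 : (M 1).re = -eulerMascheroniConstant := by
    rw [hM, mellin]; simp only [e1]
    rw [integral_complex_ofReal, integral_log_mul_exp_neg.2, Complex.ofReal_re]
  have hDd : HasDerivAt (fun x : ℝ => (M x).re) V 1 := by
    have hVre : (mellin (fun t : ℝ => log t • log t • (Real.exp (-t) : ℂ)) 1).re = V := by
      rw [mellin]; simp only [e]
      rw [integral_complex_ofReal, Complex.ofReal_re]
    rw [← hVre]
    exact HasDerivAt.real_of_complex (z := 1) (by rw [Complex.ofReal_one]; exact h4)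
  have hG : ∀ x : ℝ, 0 < x → HasDerivAt Real.Gamma (M x).re x := by
    intro x hx
    have h := HasDerivAt.real_of_complex (hasDerivAt_mellin_log_exp (s := x) (by simpa using hx)).2.1
    refine h.congr_of_eventuallyEq ?_
    filter_upwards [lt_mem_nhds hx] with y hy
    rw [← Complex.GammaIntegral_eq_mellin, ← Complex.Gamma_eq_integral (by simpa using hy),
      Complex.Gamma_ofReal, Complex.ofReal_re]
  set f : ℝ → ℝ := fun x => Real.Gamma (1 + x) * Real.Gamma (1 - x) - 1 with hf
  set f' : ℝ → ℝ := fun x => (M ((1 + x : ℝ) : ℂ)).re * Real.Gamma (1 - x) -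
    Real.Gamma (1 + x) * (M ((1 - x : ℝ) : ℂ)).re with hf'
  have hnear : ∀ᶠ x : ℝ in 𝓝 0, |x| < 1 := by
    have : ContinuousAt (fun y : ℝ => |y|) 0 := by fun_prop
    exact this.eventually (gt_mem_nhds (by simp : |(0 : ℝ)| < 1))
  have hp : ∀ x : ℝ, HasDerivAt (fun x : ℝ => 1 + x) 1 x := fun x => (hasDerivAt_id x).const_add 1
  have hm : ∀ x : ℝ, HasDerivAt (fun x : ℝ => 1 - x) (-1) x := fun x => (hasDerivAt_id x).const_sub 1
  have hfd : ∀ x : ℝ, |x| < 1 → HasDerivAt f (f' x) x := by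
    intro x hx
    obtain ⟨hx1, hx2⟩ := abs_lt.1 hx
    have a1 := HasDerivAt.comp x (hG (1 + x) (by linarith)) (hp x)
    have a2 := HasDerivAt.comp x (hG (1 - x) (by linarith)) (hm x)
    refine ((a1.mul a2).sub_const 1).congr_deriv ?_
    simp only [hf', Function.comp]; ring
  have hf'd : HasDerivAt f' (2 * (V - eulerMascheroniConstant ^ 2)) 0 := by
    have a1 := HasDerivAt.comp (0 : ℝ) (h₂ := Real.Gamma) (hG (1 + 0) (by norm_num)) (hp 0)
    have a2 := HasDerivAt.comp (0 : ℝ) (h₂ := Real.Gamma) (hG (1 - 0) (by norm_num)) (hm 0)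
    have a3 := HasDerivAt.comp (0 : ℝ) (h₂ := fun x : ℝ => (M x).re) (h₂' := V)
      (by simpa using hDd) (hp 0)
    have a4 := HasDerivAt.comp (0 : ℝ) (h₂ := fun x : ℝ => (M x).re) (h₂' := V)
      (by simpa using hDd) (hm 0)
    refine ((a3.mul a2).sub (a1.mul a4)).congr_deriv ?_
    simp [hD1, Real.Gamma_one]; ring
  have hf'0 : f' 0 = 0 := by simp [hf', Real.Gamma_one]
  have hlim1 : Tendsto (fun x => f' x / (2 * x)) (𝓝[≠] 0) (𝓝 (V - eulerMascheroniConstant ^ 2)) := by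
    have := hf'd.tendsto_slope.div_const 2
    rw [mul_div_cancel_left₀ _ (two_ne_zero)] at this
    refine this.congr fun x => ?_
    rw [slope_def_field, hf'0]
    simp only [sub_zero]; rw [div_div, mul_comm x 2]
  -- L'Hôpital is applied once only: the derivative of `f'` has been computed just at `0`, and it
  -- enters as the limit of the slope of `f'`.
  have hlim2 : Tendsto (fun x => f x / x ^ 2) (𝓝[≠] 0) (𝓝 (V - eulerMascheroniConstant ^ 2)) := by
    refine HasDerivAt.lhopital_zero_nhdsNE (f' := f') (g' := fun x => 2 * x) ?_ ?_ ?_ ?_ ?_ hlim1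
    · filter_upwards [nhdsWithin_le_nhds hnear] with x hx using hfd x hx
    · exact Eventually.of_forall fun x => by simpa using! (hasDerivAt_id x).pow 2
    · filter_upwards [self_mem_nhdsWithin] with x hx
      exact mul_ne_zero two_ne_zero hx
    · have := (hfd 0 (by simp)).continuousAt.tendsto.mono_left (nhdsWithin_le_nhds (s := {0}ᶜ))
      simpa [hf, Real.Gamma_one] using this
    · have : ContinuousAt (fun x : ℝ => x ^ 2) 0 := by fun_prop
      have := this.tendsto.mono_left (nhdsWithin_le_nhds (s := {0}ᶜ))
      simpa using this
  have hlim3 : Tendsto (fun x => f x / x ^ 2) (𝓝[≠] 0) (𝓝 (π ^ 2 / 6)) := by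
    have hpi : Tendsto (fun x : ℝ => π * x) (𝓝[≠] 0) (𝓝[≠] 0) := by
      refine tendsto_nhdsWithin_iff.2 ⟨?_, ?_⟩
      · have : ContinuousAt (fun x : ℝ => π * x) 0 := by fun_prop
        simpa using this.tendsto.mono_left (nhdsWithin_le_nhds (s := {0}ᶜ))
      · filter_upwards [self_mem_nhdsWithin] with x hx
        exact mul_ne_zero pi_ne_zero hx
    have b1 := tendsto_self_sub_sin_div_cube.comp hpi
    have b2 : Tendsto (fun y : ℝ => sin y / y) (𝓝[≠] 0) (𝓝 1) := by
      have := (hasDerivAt_sin 0).tendsto_slope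
      rw [cos_zero] at this
      refine this.congr fun x => ?_
      rw [slope_def_field]; simp
    have b3 := (b1.div (b2.comp hpi) one_ne_zero).const_mul (π ^ 2)
    rw [show π ^ 2 * (1 / 6 / 1) = π ^ 2 / 6 by ring] at b3
    refine b3.congr' ?_
    filter_upwards [nhdsWithin_le_nhds hnear, self_mem_nhdsWithin] with x hx hx0
    have hx0 : x ≠ 0 := hx0
    have hs : sin (π * x) ≠ 0 := by
      obtain ⟨hx1, hx2⟩ := abs_lt.1 hx
      rw [Ne, Real.sin_eq_zero_iff_of_lt_of_lt (by nlinarith [pi_pos]) (by nlinarith [pi_pos])]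
      exact mul_ne_zero pi_ne_zero hx0
    have hr := Real.Gamma_mul_Gamma_one_sub x
    have : Real.Gamma (1 + x) = x * Real.Gamma x := by rw [add_comm, Real.Gamma_add_one hx0]
    simp only [Pi.div_apply, Function.comp_apply, hf, this]
    rw [mul_assoc, hr]
    have := pi_ne_zero
    field_simp
  have := tendsto_nhds_unique hlim2 hlim3
  linarith

/-- The logarithm, centred for the exponential distribution of rate `2`. -/
def shiftedLog (x : ℝ) : ℝ := log x + (log 2 + eulerMascheroniConstant)

theorem integral_Ioi_comp_two_mul {g : ℝ → ℝ} {A m : ℝ} (hm : 0 < m) (hi : IntegrableOn g (Ioi 0))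
    (hv : ∫ y in Ioi (0 : ℝ), g y = A) :
    IntegrableOn (fun x : ℝ => g (2 * m * x)) (Ioi 0) ∧
      ∫ x in Ioi (0 : ℝ), g (2 * m * x) = A / (2 * m) := by
  have hm2 : 0 < 2 * m := by positivity
  constructor
  · rw [integrableOn_Ioi_comp_mul_left_iff g 0 hm2, mul_zero]
    exact hi
  · rw [integral_comp_mul_left_Ioi g 0 hm2, mul_zero, hv, smul_eq_mul, inv_mul_eq_div]

theorem integral_exp_neg_two_mul {m : ℝ} (hm : 0 < m) :
    IntegrableOn (fun x : ℝ => exp (-(2 * m * x))) (Ioi 0) ∧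
      ∫ x in Ioi (0 : ℝ), exp (-(2 * m * x)) = 1 / (2 * m) :=
  integral_Ioi_comp_two_mul hm (integrableOn_exp_neg_Ioi 0) (by rw [integral_exp_neg_Ioi, neg_zero, exp_zero])

theorem log_add_eq_shiftedLog {m x : ℝ} (hm : 0 < m) (hx : 0 < x) :
    log (2 * m * x) + (eulerMascheroniConstant - log m) = shiftedLog x := by
  rw [shiftedLog, log_mul (by positivity) hx.ne', log_mul two_ne_zero hm.ne']; ring

theorem integral_shiftedLog_mul_exp {m : ℝ} (hm : 0 < m) :
    IntegrableOn (fun x : ℝ => shiftedLog x * exp (-(2 * m * x))) (Ioi 0) ∧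
      ∫ x in Ioi (0 : ℝ), shiftedLog x * exp (-(2 * m * x)) = -log m / (2 * m) := by
  set d := eulerMascheroniConstant - log m with hd
  obtain ⟨i1, v1⟩ := integral_log_mul_exp_neg
  have i0 := integrableOn_exp_neg_Ioi 0
  have hi : IntegrableOn (fun y : ℝ => log y * exp (-y) + d * exp (-y)) (Ioi 0) :=
    i1.add (i0.const_mul d)
  have hv : ∫ y in Ioi (0 : ℝ), (log y * exp (-y) + d * exp (-y)) = -log m := by
    rw [integral_add i1 (i0.const_mul d), v1, integral_const_mul, integral_exp_neg_Ioi]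
    rw [neg_zero, exp_zero, hd]; ring
  obtain ⟨a, b⟩ := integral_Ioi_comp_two_mul hm hi hv
  have e : ∀ x ∈ Ioi (0 : ℝ), log (2 * m * x) * exp (-(2 * m * x)) + d * exp (-(2 * m * x)) =
      shiftedLog x * exp (-(2 * m * x)) := by
    intro x hx; rw [← log_add_eq_shiftedLog hm hx]; ring
  exact ⟨a.congr_fun e measurableSet_Ioi, by rw [← b, setIntegral_congr_fun measurableSet_Ioi e]⟩

/-- With `y = 2mx` one has `shiftedLog x = log y + γ - log m`. For the exponential law `log y` has
mean `-γ` and variance `π²/6`, so the shifted variable has mean `-log m` and the same variance. -/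
theorem integral_shiftedLog_sq_mul_exp {m : ℝ} (hm : 0 < m) :
    IntegrableOn (fun x : ℝ => shiftedLog x ^ 2 * exp (-(2 * m * x))) (Ioi 0) ∧
      ∫ x in Ioi (0 : ℝ), shiftedLog x ^ 2 * exp (-(2 * m * x)) =
        (π ^ 2 / 6 + log m ^ 2) / (2 * m) := by
  set d := eulerMascheroniConstant - log m with hd
  obtain ⟨i1, v1⟩ := integral_log_mul_exp_neg
  obtain ⟨i2, v2⟩ := integral_log_sq_mul_exp_neg
  have i0 := integrableOn_exp_neg_Ioi 0
  have i01 : IntegrableOn (fun y : ℝ => 2 * d * (log y * exp (-y)) + d ^ 2 * exp (-y)) (Ioi 0) :=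
    (i1.const_mul (2 * d)).add (i0.const_mul (d ^ 2))
  have hi : IntegrableOn (fun y : ℝ => log y ^ 2 * exp (-y) +
      (2 * d * (log y * exp (-y)) + d ^ 2 * exp (-y))) (Ioi 0) := i2.add i01
  have hv : ∫ y in Ioi (0 : ℝ), (log y ^ 2 * exp (-y) +
      (2 * d * (log y * exp (-y)) + d ^ 2 * exp (-y))) = π ^ 2 / 6 + log m ^ 2 := by
    rw [integral_add i2 i01, integral_add (i1.const_mul (2 * d)) (i0.const_mul (d ^ 2)), v2,
      integral_const_mul, integral_const_mul, v1, integral_exp_neg_Ioi]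
    rw [neg_zero, exp_zero, hd]; ring
  obtain ⟨a, b⟩ := integral_Ioi_comp_two_mul hm hi hv
  have e : ∀ x ∈ Ioi (0 : ℝ), log (2 * m * x) ^ 2 * exp (-(2 * m * x)) +
      (2 * d * (log (2 * m * x) * exp (-(2 * m * x))) + d ^ 2 * exp (-(2 * m * x))) =
      shiftedLog x ^ 2 * exp (-(2 * m * x)) := by
    intro x hx; rw [← log_add_eq_shiftedLog hm hx]; ring
  exact ⟨a.congr_fun e measurableSet_Ioi, by rw [← b, setIntegral_congr_fun measurableSet_Ioi e]⟩

/-! ### Logarithmic moments of `1 / cosh²` -/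

theorem one_div_cosh_sq (x : ℝ) :
    1 / cosh x ^ 2 = 4 * exp (-(2 * x)) / (1 + exp (-(2 * x))) ^ 2 := by
  have h1 : exp (-(2 * x)) = exp (-x) * exp (-x) := by rw [← exp_add]; ring_nf
  have h2 : exp x * exp (-x) = 1 := by rw [← exp_add]; simp
  have h3 : cosh x = exp x * (1 + exp (-(2 * x))) / 2 := by
    rw [cosh_eq, h1]
    linear_combination (-exp (-x) / 2) * h2
  have h4 : exp x ≠ 0 := (exp_pos x).ne'
  have h5 : exp (-(2 * x)) * exp x ^ 2 = 1 := by
    rw [h1]; linear_combination (exp x * exp (-x) + 1) * h2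
  have h6 : 0 < 1 + exp (-(2 * x)) := by positivity
  rw [h3]
  field_simp
  linear_combination (-4) * h5

theorem one_div_cosh_sq_le (x : ℝ) : 1 / cosh x ^ 2 ≤ 4 * exp (-(2 * x)) := by
  rw [one_div_cosh_sq]
  have := exp_pos (-(2 * x))
  exact div_le_self (by positivity) (by nlinarith)

theorem tanh_eq_exp (x : ℝ) : tanh x = 1 - 2 * exp (-(2 * x)) / (1 + exp (-(2 * x))) := by
  have h1 : exp (-(2 * x)) = exp (-x) * exp (-x) := by rw [← exp_add]; ring_nf
  have h2 : exp x * exp (-x) = 1 := by rw [← exp_add]; simp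
  have h4 := exp_pos x
  have h5 := exp_pos (-x)
  rw [tanh_eq, h1]
  field_simp
  linear_combination (2 * exp (-x)) * h2

theorem hasDerivAt_tanh (x : ℝ) : HasDerivAt tanh (1 / cosh x ^ 2) x := by
  have h := (hasDerivAt_sinh x).div (hasDerivAt_cosh x) (cosh_pos x).ne'
  have e : tanh = sinh / cosh := funext fun y => tanh_eq_sinh_div_cosh y
  rw [e]
  refine h.congr_deriv ?_
  rw [← cosh_sq_sub_sinh_sq x]; ring

theorem continuous_tanh : Continuous tanh :=
  continuous_iff_continuousAt.2 fun x => (hasDerivAt_tanh x).continuousAt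

theorem tendsto_tanh_atTop : Tendsto tanh atTop (𝓝 1) := by
  have h : Tendsto (fun x : ℝ => exp (-(2 * x))) atTop (𝓝 0) :=
    tendsto_exp_neg_atTop_nhds_zero.comp (tendsto_id.const_mul_atTop two_pos)
  have h2 := (((h.const_mul 2).div (h.const_add 1) (by norm_num)).const_sub 1)
  norm_num at h2
  exact h2.congr fun x => by simp [tanh_eq_exp]

theorem integral_one_div_cosh_sq :
    IntegrableOn (fun x : ℝ => 1 / cosh x ^ 2) (Ioi 0) ∧
      ∫ x in Ioi (0 : ℝ), 1 / cosh x ^ 2 = 1 := by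
  have h0 : ContinuousWithinAt tanh (Ici 0) 0 := continuous_tanh.continuousWithinAt
  have hn : ∀ x ∈ Ioi (0 : ℝ), 0 ≤ 1 / cosh x ^ 2 := fun x _ => by positivity
  refine ⟨integrableOn_Ioi_deriv_of_nonneg h0 (fun x _ => hasDerivAt_tanh x) hn tendsto_tanh_atTop,
    ?_⟩
  rw [integral_Ioi_of_hasDerivAt_of_nonneg h0 (fun x _ => hasDerivAt_tanh x) hn tendsto_tanh_atTop]
  simp

@[fun_prop]
theorem measurable_shiftedLog : Measurable shiftedLog := by unfold shiftedLog; fun_prop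

theorem integrableOn_mul_of_le_exp {f w : ℝ → ℝ} (hf : Measurable f) (hw : Measurable w) {C : ℝ}
    (hi : IntegrableOn (fun x => f x * exp (-(2 * 1 * x))) (Ioi 0))
    (hb : ∀ x, 0 < x → |w x| ≤ C * exp (-(2 * x))) :
    IntegrableOn (fun x => f x * w x) (Ioi 0) := by
  refine Integrable.mono' (hi.norm.const_mul C) (by fun_prop) ?_
  filter_upwards [ae_restrict_mem measurableSet_Ioi] with x hx
  rw [norm_mul, norm_mul, Real.norm_of_nonneg (exp_pos _).le, mul_left_comm, mul_one]
  exact mul_le_mul_of_nonneg_left (hb x hx) (norm_nonneg _)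

theorem abs_one_div_cosh_sq_le (x : ℝ) : |1 / cosh x ^ 2| ≤ 4 * exp (-(2 * x)) := by
  rw [abs_of_nonneg (by positivity)]; exact one_div_cosh_sq_le x

theorem integrableOn_shiftedLog_sech :
    IntegrableOn (fun x => shiftedLog x * (1 / cosh x ^ 2)) (Ioi 0) :=
  integrableOn_mul_of_le_exp (by fun_prop) (by fun_prop)
    (integral_shiftedLog_mul_exp one_pos).1 fun x _ => abs_one_div_cosh_sq_le x

theorem integrableOn_shiftedLog_sq_sech :
    IntegrableOn (fun x => shiftedLog x ^ 2 * (1 / cosh x ^ 2)) (Ioi 0) :=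
  integrableOn_mul_of_le_exp (by fun_prop) (by fun_prop)
    (integral_shiftedLog_sq_mul_exp one_pos).1 fun x _ => abs_one_div_cosh_sq_le x

/-- The remainder after `N = 2 M` terms of the expansion of `1 / cosh²` in powers of `e^{-2x}`. -/
def sechRemainder (N : ℕ) (x : ℝ) : ℝ :=
  4 * exp (-(2 * x)) ^ N * ((N + 1) * exp (-(2 * x)) + N * exp (-(2 * x)) ^ 2) /
    (1 + exp (-(2 * x))) ^ 2

/-- An even number of terms is kept so that the remainder carries no sign and is manifestly
nonnegative for `q ≥ 0`. -/
theorem div_one_add_sq_eq (q : ℝ) (hq : 0 < 1 + q) (M : ℕ) :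
    q / (1 + q) ^ 2 = ∑ n ∈ Finset.range (2 * M), (-1) ^ n * ((n : ℝ) + 1) * q ^ (n + 1) +
      q ^ (2 * M) * (((2 * M : ℕ) + 1) * q + (2 * M : ℕ) * q ^ 2) / (1 + q) ^ 2 := by
  induction M with
  | zero => simp
  | succ M ih =>
    rw [show 2 * (M + 1) = 2 * M + 1 + 1 by ring, Finset.sum_range_succ, Finset.sum_range_succ, ih,
      pow_succ (-1 : ℝ) (2 * M), pow_mul (-1 : ℝ)]
    push_cast
    field_simp
    ring

theorem one_div_cosh_sq_eq_sum (M : ℕ) (x : ℝ) : 1 / cosh x ^ 2 =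
    ∑ n ∈ Finset.range (2 * M), 4 * (-1) ^ n * ((n : ℝ) + 1) * exp (-(2 * ((n : ℝ) + 1) * x)) +
      sechRemainder (2 * M) x := by
  have hq : 0 < 1 + exp (-(2 * x)) := by positivity
  have e : ∀ n : ℕ, exp (-(2 * ((n : ℝ) + 1) * x)) = exp (-(2 * x)) ^ (n + 1) := by
    intro n; rw [← exp_nat_mul]; push_cast; ring_nf
  rw [one_div_cosh_sq, mul_div_assoc, div_one_add_sq_eq _ hq M, mul_add, Finset.mul_sum]
  congr 1
  · refine Finset.sum_congr rfl fun n _ => ?_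
    rw [e]; ring
  · rw [sechRemainder]; ring

/-- The remainder lives at scale `x ~ 1/N`, where `q^N` becomes `e^(-2y)` and the other exponentials
tend to `1`. -/
theorem sechRemainder_scaled {N : ℕ} (hN : N ≠ 0) (y : ℝ) :
    sechRemainder N ((N : ℝ)⁻¹ * y) * (N : ℝ)⁻¹ = 4 * exp (-(2 * y)) *
      ((1 + (N : ℝ)⁻¹) * exp (-(2 * ((N : ℝ)⁻¹ * y))) + exp (-(2 * ((N : ℝ)⁻¹ * y))) ^ 2) /
        (1 + exp (-(2 * ((N : ℝ)⁻¹ * y)))) ^ 2 := by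
  have hN' : (N : ℝ) ≠ 0 := Nat.cast_ne_zero.2 hN
  have e : exp (-(2 * ((N : ℝ)⁻¹ * y))) ^ N = exp (-(2 * y)) := by
    rw [← exp_nat_mul]; congr 1; field_simp
  have hq : 0 < 1 + exp (-(2 * ((N : ℝ)⁻¹ * y))) := by positivity
  rw [sechRemainder, e]
  field_simp

@[fun_prop]
theorem measurable_sechRemainder (N : ℕ) : Measurable (sechRemainder N) := by
  unfold sechRemainder; fun_prop

/-- The rescaled remainder converges to `2 e^(-2y)`, for which `shiftedLog` has mean zero by its
choice of centre. Domination holds with `12 = 4 · 3`. -/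
theorem tendsto_integral_shiftedLog_sechRemainder :
    Tendsto (fun N : ℕ => ∫ y in Ioi (0 : ℝ),
      shiftedLog y * (sechRemainder N ((N : ℝ)⁻¹ * y) * (N : ℝ)⁻¹)) atTop (𝓝 0) := by
  obtain ⟨hi, hv⟩ := integral_shiftedLog_mul_exp one_pos
  have hv2 : ∫ y in Ioi (0 : ℝ), shiftedLog y * (2 * exp (-(2 * y))) = 0 := by
    have : ∀ y : ℝ, shiftedLog y * (2 * exp (-(2 * y))) =
        2 * (shiftedLog y * exp (-(2 * 1 * y))) := by intro y; ring_nf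
    simp only [this]
    rw [integral_const_mul, hv]; simp
  suffices h : Tendsto (fun N : ℕ => ∫ y in Ioi (0 : ℝ),
      shiftedLog y * (sechRemainder N ((N : ℝ)⁻¹ * y) * (N : ℝ)⁻¹)) atTop
      (𝓝 (∫ y in Ioi (0 : ℝ), shiftedLog y * (2 * exp (-(2 * y))))) by rwa [hv2] at h
  refine tendsto_integral_filter_of_dominated_convergence
    (fun y => 12 * ‖shiftedLog y * exp (-(2 * 1 * y))‖) ?_ ?_ (hi.norm.const_mul 12) ?_
  · exact Eventually.of_forall fun N => Measurable.aestronglyMeasurable (by fun_prop)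
  · filter_upwards [eventually_ge_atTop 1] with N hN
    filter_upwards [ae_restrict_mem measurableSet_Ioi] with y hy
    have hy : 0 < y := hy
    have hN1 : (1 : ℝ) ≤ N := by exact_mod_cast hN
    rw [sechRemainder_scaled (by omega), norm_mul, norm_mul, mul_left_comm (12 : ℝ)]
    refine mul_le_mul_of_nonneg_left ?_ (norm_nonneg _)
    have hq0 := exp_pos (-(2 * ((N : ℝ)⁻¹ * y)))
    have hq1 : exp (-(2 * ((N : ℝ)⁻¹ * y))) ≤ 1 := by
      rw [exp_le_one_iff]; have : 0 < (N : ℝ)⁻¹ * y := by positivity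
      linarith
    have hinv : (N : ℝ)⁻¹ ≤ 1 := inv_le_one_of_one_le₀ hN1
    have hinv0 : 0 < (N : ℝ)⁻¹ := by positivity
    set q := exp (-(2 * ((N : ℝ)⁻¹ * y)))
    have hE := exp_pos (-(2 * y))
    rw [Real.norm_of_nonneg (by positivity), Real.norm_of_nonneg (exp_pos _).le, mul_one,
      div_le_iff₀ (by positivity)]
    have h3 : (1 + (N : ℝ)⁻¹) * q + q ^ 2 ≤ 3 * (1 + q) ^ 2 := by nlinarith
    nlinarith
  · filter_upwards with y
    refine Tendsto.const_mul _ ?_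
    have h1 : Tendsto (fun N : ℕ => (N : ℝ)⁻¹) atTop (𝓝 0) :=
      tendsto_inv_atTop_zero.comp tendsto_natCast_atTop_atTop
    have h2 : Tendsto (fun N : ℕ => exp (-(2 * ((N : ℝ)⁻¹ * y)))) atTop (𝓝 1) := by
      have : ContinuousAt (fun t : ℝ => exp (-(2 * (t * y)))) 0 := by fun_prop
      have h := this.tendsto.comp h1
      simpa [Function.comp_def] using h
    have h3 := ((((h1.const_add 1).mul h2).add (h2.pow 2)).const_mul (4 * exp (-(2 * y)))).div
      ((h2.const_add 1).pow 2) (by norm_num)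
    rw [show 4 * exp (-(2 * y)) * ((1 + 0) * 1 + 1 ^ 2) / (1 + 1) ^ 2 = 2 * exp (-(2 * y)) by ring]
      at h3
    refine h3.congr' ?_
    filter_upwards [eventually_ge_atTop 1] with N hN
    rw [sechRemainder_scaled (by omega)]; rfl

theorem integral_mul_sechRemainder {f : ℝ → ℝ} {A : ℕ → ℝ} {C : ℝ} (M : ℕ)
    (hf : ∀ n : ℕ, IntegrableOn (fun x => f x * exp (-(2 * ((n : ℝ) + 1) * x))) (Ioi 0) ∧
      ∫ x in Ioi (0 : ℝ), f x * exp (-(2 * ((n : ℝ) + 1) * x)) = A n / (2 * ((n : ℝ) + 1)))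
    (hs : IntegrableOn (fun x => f x * (1 / cosh x ^ 2)) (Ioi 0))
    (hC : ∫ x in Ioi (0 : ℝ), f x * (1 / cosh x ^ 2) = C) :
    IntegrableOn (fun x => f x * sechRemainder (2 * M) x) (Ioi 0) ∧
    ∫ x in Ioi (0 : ℝ), f x * sechRemainder (2 * M) x =
      C - ∑ n ∈ Finset.range (2 * M), 2 * (-1) ^ n * A n := by
  have hsum : IntegrableOn (fun x => ∑ n ∈ Finset.range (2 * M),
      4 * (-1) ^ n * ((n : ℝ) + 1) * (f x * exp (-(2 * ((n : ℝ) + 1) * x)))) (Ioi 0) :=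
    integrable_finsetSum _ fun n _ => (hf n).1.const_mul _
  have e : ∀ x : ℝ, f x * sechRemainder (2 * M) x = f x * (1 / cosh x ^ 2) -
      ∑ n ∈ Finset.range (2 * M),
        4 * (-1) ^ n * ((n : ℝ) + 1) * (f x * exp (-(2 * ((n : ℝ) + 1) * x))) := by
    intro x
    rw [one_div_cosh_sq_eq_sum M x, mul_add, Finset.mul_sum, add_sub_right_comm,
      ← Finset.sum_sub_distrib, Finset.sum_eq_zero, zero_add]
    intro n _; ring
  simp only [e]
  refine ⟨hs.sub hsum, ?_⟩
  rw [integral_sub hs hsum, hC, integral_finsetSum _ fun n _ => (hf n).1.const_mul _]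
  congr 1
  refine Finset.sum_congr rfl fun n _ => ?_
  have : (n : ℝ) + 1 ≠ 0 := by positivity
  rw [integral_const_mul, (hf n).2]
  field_simp
  ring

/-- Both sides are the logarithm of the square of `∏ 2k/(2k-1)` over `1 ≤ k ≤ M`. -/
theorem two_mul_sum_log_eq (M : ℕ) :
    ∑ n ∈ Finset.range (2 * M), 2 * (-1) ^ n * (-log ((n : ℝ) + 1)) =
      log (Wallis.W M * (2 * M + 1)) := by
  induction M with
  | zero => simp [Wallis.W]
  | succ M ih =>
    have hW := Wallis.W_pos M
    rw [show 2 * (M + 1) = 2 * M + 1 + 1 by ring, Finset.sum_range_succ, Finset.sum_range_succ, ih,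
      pow_succ (-1 : ℝ) (2 * M), pow_mul (-1 : ℝ), Wallis.W_succ]
    have e : Wallis.W M * ((2 * M + 2) / (2 * M + 1) * ((2 * M + 2) / (2 * M + 3))) *
        (2 * ((M + 1 : ℕ) : ℝ) + 1) = Wallis.W M * (2 * M + 1) * ((2 * M + 2) / (2 * M + 1)) ^ 2 := by
      push_cast; field_simp; ring
    have e2 : log (Wallis.W M * (2 * M + 1) * ((2 * M + 2) / (2 * M + 1)) ^ 2) =
        log (Wallis.W M * (2 * M + 1)) + 2 * (log (2 * M + 2) - log (2 * M + 1)) := by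
      rw [log_mul (by positivity) (by positivity), log_pow,
        log_div (by positivity) (by positivity)]
      norm_num
    rw [e, e2]
    push_cast
    rw [show (2 * (M : ℝ) + 1 + 1) = 2 * M + 2 by ring]
    norm_num
    ring

/-- The first `2M` terms sum to `log (W_M (2M + 1))`. Rescaling the remainder, whose total mass is
1, produces `-log (2M)`, and what is left tends to zero. Wallis' product then gives the limit `log
(π/2)`. -/
theorem integral_shiftedLog_sech :
    ∫ x in Ioi (0 : ℝ), shiftedLog x * (1 / cosh x ^ 2) = log (π / 2) := by
  set C := ∫ x in Ioi (0 : ℝ), shiftedLog x * (1 / cosh x ^ 2) with hC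
  have h0 : ∀ M : ℕ, ∫ x in Ioi (0 : ℝ), sechRemainder (2 * M) x = 1 ∧
      IntegrableOn (sechRemainder (2 * M)) (Ioi 0) := by
    intro M
    have h := integral_mul_sechRemainder (f := fun _ => 1) (A := fun _ => 1) M
      (fun n => by simpa only [one_mul] using integral_exp_neg_two_mul (by positivity))
      (by simpa only [one_mul] using integral_one_div_cosh_sq.1)
      (by simpa only [one_mul] using integral_one_div_cosh_sq.2)
    simp only [one_mul, mul_one, ← Finset.mul_sum] at h
    refine ⟨?_, h.1⟩
    rw [h.2]
    have : ∑ n ∈ Finset.range (2 * M), (-1 : ℝ) ^ n = 0 := by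
      rw [neg_one_geom_sum]; simp
    rw [this]; simp
  have h1 : ∀ M : ℕ, M ≠ 0 → C = log (Wallis.W M * (2 * M + 1)) - log ((2 * M : ℕ) : ℝ) +
      ∫ y in Ioi (0 : ℝ), shiftedLog y *
        (sechRemainder (2 * M) (((2 * M : ℕ) : ℝ)⁻¹ * y) * ((2 * M : ℕ) : ℝ)⁻¹) := by
    intro M hM
    have hN : (0 : ℝ) < ((2 * M : ℕ) : ℝ) := by
      have := Nat.pos_of_ne_zero hM; positivity
    set N : ℝ := ((2 * M : ℕ) : ℝ) with hNdef
    obtain ⟨hi, hv⟩ := integral_mul_sechRemainder (f := shiftedLog) (A := fun n => -log ((n : ℝ) + 1))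
      (C := C) M (fun n => integral_shiftedLog_mul_exp (by positivity)) integrableOn_shiftedLog_sech
      hC.symm
    rw [two_mul_sum_log_eq] at hv
    have hsub : ∫ y in Ioi (0 : ℝ), shiftedLog y * (sechRemainder (2 * M) (N⁻¹ * y) * N⁻¹) =
        (∫ x in Ioi (0 : ℝ), shiftedLog x * sechRemainder (2 * M) x) + log N := by
      have e : ∀ y ∈ Ioi (0 : ℝ), shiftedLog y * (sechRemainder (2 * M) (N⁻¹ * y) * N⁻¹) =
          N⁻¹ * ((fun x => shiftedLog x * sechRemainder (2 * M) x + log N * sechRemainder (2 * M) x)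
            (N⁻¹ * y)) := by
        intro y hy
        have hy : 0 < y := hy
        simp only [shiftedLog]
        rw [log_mul (by positivity) hy.ne', log_inv]; ring
      rw [setIntegral_congr_fun measurableSet_Ioi e, integral_const_mul,
        integral_comp_mul_left_Ioi
          (fun x => shiftedLog x * sechRemainder (2 * M) x + log N * sechRemainder (2 * M) x) 0
          (inv_pos.2 hN), mul_zero, smul_eq_mul, inv_inv,
        inv_mul_cancel_left₀ hN.ne', integral_add hi ((h0 M).2.const_mul _), integral_const_mul,
        (h0 M).1, mul_one]
    rw [hsub, hv]; ring
  have h2 : Tendsto (fun M : ℕ => 2 * M) atTop atTop :=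
    tendsto_id.const_mul_atTop' two_pos
  have h3 := tendsto_integral_shiftedLog_sechRemainder.comp h2
  have h4 : Tendsto (fun M : ℕ => log (Wallis.W M * (2 * M + 1)) - log ((2 * M : ℕ) : ℝ)) atTop
      (𝓝 (log (π / 2))) := by
    have h5 : Tendsto (fun M : ℕ => Wallis.W M * (1 + (((2 * M : ℕ) : ℝ))⁻¹)) atTop
        (𝓝 (π / 2 * (1 + 0))) :=
      Wallis.tendsto_W_nhds_pi_div_two.mul
        ((tendsto_inv_atTop_zero.comp (tendsto_natCast_atTop_atTop.comp h2)).const_add 1)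
    rw [add_zero, mul_one] at h5
    refine ((continuousAt_log (by positivity)).tendsto.comp h5).congr' ?_
    filter_upwards [eventually_ge_atTop 1] with M hM
    have hM0 : (0 : ℝ) < M := by exact_mod_cast hM
    have hW := Wallis.W_pos M
    rw [Function.comp_apply, ← log_div (by positivity) (by positivity)]
    congr 1; push_cast; field_simp
  have h6 := h4.add h3
  rw [add_zero] at h6
  refine tendsto_nhds_unique (tendsto_const_nhds.congr' ?_) h6
  filter_upwards [eventually_ge_atTop 1] with M hM
  exact h1 M (by omega)

/-! ### The second logarithmic moment of `1 / cosh²` and the constant `a₁` -/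

/-- The weights of the truncated Euler transform of an alternating series. -/
def eulerWeight (K m : ℕ) : ℚ :=
  (-1) ^ m * ∑ k ∈ Finset.range K, ((k + 1).choose (m + 1) : ℚ) / 2 ^ (k + 1)

theorem sum_succ_mul_pow_mul (z : ℝ) (K : ℕ) :
    (∑ k ∈ Finset.range K, ((k : ℝ) + 1) * z ^ k) * (1 - z) ^ 2 =
      1 - z ^ K * (K + 1 - K * z) := by
  induction K with
  | zero => simp
  | succ K ih =>
    rw [Finset.sum_range_succ, add_mul, ih]
    push_cast
    ring

/-- Binomial expansion with `(k+1) C(k,m) = (m+1) C(k+1,m+1)`. The sum is padded by zero terms up to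
`K` so that the order of summation over `k` and `m` can be exchanged. -/
theorem succ_mul_mul_one_sub_pow (q : ℝ) {k K : ℕ} (hk : k < K) :
    ((k : ℝ) + 1) * (q * (1 - q) ^ k) =
      ∑ m ∈ Finset.range K, (-1) ^ m * ((k + 1).choose (m + 1) : ℝ) * (((m : ℝ) + 1) * q ^ (m + 1)) := by
  have h1 : ∑ m ∈ Finset.range K,
      (-1) ^ m * ((k + 1).choose (m + 1) : ℝ) * (((m : ℝ) + 1) * q ^ (m + 1)) =
      ∑ m ∈ Finset.range (k + 1),
      (-1) ^ m * ((k + 1).choose (m + 1) : ℝ) * (((m : ℝ) + 1) * q ^ (m + 1)) := by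
    symm
    refine Finset.sum_subset (fun x hx => ?_) fun m _ hm => ?_
    · rw [Finset.mem_range] at hx ⊢; omega
    · rw [Finset.mem_range, not_lt] at hm
      rw [Nat.choose_eq_zero_of_lt (by omega)]; simp
  rw [h1, sub_eq_neg_add, add_pow, Finset.mul_sum, Finset.mul_sum]
  refine Finset.sum_congr rfl fun m _ => ?_
  have h2 : ((k : ℝ) + 1) * (k.choose m : ℝ) = ((k + 1).choose (m + 1) : ℝ) * ((m : ℝ) + 1) := by
    exact_mod_cast Nat.add_one_mul_choose_eq k m
  rw [neg_pow, one_pow, mul_one]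
  linear_combination ((-1) ^ m * q ^ (m + 1)) * h2

/-- The remainder of the truncated Euler transform of `1 / cosh²`. -/
def eulerRemainder (K : ℕ) (x : ℝ) : ℝ :=
  1 / cosh x ^ 2 -
    ∑ m ∈ Finset.range K, 2 * (eulerWeight K m : ℝ) * ((m : ℝ) + 1) * exp (-(2 * ((m : ℝ) + 1) * x))

/-- With `q = e^(-2x)` and `z = (1 - q)/2`, one has `1/cosh² x = q/(1 - z)² = q Σ (k+1) z^k`. Since
`0 ≤ z ≤ 1/2`, the tail is nonnegative and of size `K/2^K`, whereas the original series in `q`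
converges slowly near `x = 0`. -/
theorem eulerRemainder_bounds (K : ℕ) {x : ℝ} (hx : 0 < x) :
    0 ≤ eulerRemainder K x ∧
      eulerRemainder K x ≤ 4 * ((K : ℝ) + 1) / 2 ^ K * exp (-(2 * x)) := by
  have hq0 := exp_pos (-(2 * x))
  have hq1 : exp (-(2 * x)) ≤ 1 := by rw [exp_le_one_iff]; linarith
  set q := exp (-(2 * x)) with hq
  have e : ∀ n : ℕ, exp (-(2 * ((n : ℝ) + 1) * x)) = q ^ (n + 1) := by
    intro n; rw [hq, ← exp_nat_mul]; push_cast; ring_nf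
  set z := (1 - q) / 2 with hz
  have hz0 : 0 ≤ z := by rw [hz]; linarith
  have hz1 : z ≤ 1 / 2 := by rw [hz]; linarith
  have hsum : ∑ m ∈ Finset.range K, 2 * (eulerWeight K m : ℝ) * ((m : ℝ) + 1) *
      exp (-(2 * ((m : ℝ) + 1) * x)) = q * ∑ k ∈ Finset.range K, ((k : ℝ) + 1) * z ^ k := by
    have e2 : ∀ k ∈ Finset.range K, q * (((k : ℝ) + 1) * z ^ k) = ∑ m ∈ Finset.range K,
        2 * ((-1) ^ m * (((k + 1).choose (m + 1) : ℝ) / 2 ^ (k + 1))) * ((m : ℝ) + 1) *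
          q ^ (m + 1) := by
      intro k hk
      have h := succ_mul_mul_one_sub_pow q (Finset.mem_range.1 hk)
      calc q * (((k : ℝ) + 1) * z ^ k) = 1 / 2 ^ k * (((k : ℝ) + 1) * (q * (1 - q) ^ k)) := by
            rw [hz, div_pow]; ring
        _ = _ := by
            rw [h, Finset.mul_sum]
            refine Finset.sum_congr rfl fun m _ => ?_
            rw [pow_succ (2 : ℝ) k]; field_simp
    rw [Finset.mul_sum, Finset.sum_congr rfl e2, Finset.sum_comm]
    refine Finset.sum_congr rfl fun m _ => ?_
    rw [e, eulerWeight]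
    push_cast
    rw [Finset.mul_sum, Finset.mul_sum, Finset.sum_mul, Finset.sum_mul]
  have hmain : eulerRemainder K x = q * (z ^ K * (K + 1 - K * z)) / (1 - z) ^ 2 := by
    have h1 : (1 - z) = (1 + q) / 2 := by rw [hz]; ring
    have h2 := sum_succ_mul_pow_mul z K
    have h3 : 0 < 1 - z := by linarith
    have h4 : 1 / cosh x ^ 2 = q / (1 - z) ^ 2 := by
      rw [one_div_cosh_sq, h1]; field_simp; ring
    rw [eulerRemainder, hsum, h4, eq_div_iff (by positivity), sub_mul, div_mul_cancel₀ _ (by positivity),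
      mul_assoc, h2]
    ring
  have hz3 : 1 / 4 ≤ (1 - z) ^ 2 := by nlinarith
  have hKz : 0 ≤ (K : ℝ) * z := by positivity
  have hKz1 : (K : ℝ) * z ≤ K := by
    have : (K : ℝ) * z ≤ K * 1 := by gcongr; linarith
    linarith
  have hzK : z ^ K ≤ 1 / 2 ^ K := by rw [← one_div_pow]; gcongr
  have hA : 0 ≤ z ^ K * (K + 1 - K * z) := mul_nonneg (by positivity) (by linarith)
  rw [hmain]
  refine ⟨by positivity, ?_⟩
  rw [div_le_iff₀ (by linarith)]
  have hB : z ^ K * (K + 1 - K * z) ≤ 1 / 2 ^ K * (K + 1) :=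
    mul_le_mul hzK (by linarith) (by linarith) (by positivity)
  calc q * (z ^ K * (K + 1 - K * z)) ≤ q * (1 / 2 ^ K * (K + 1)) := by gcongr
    _ = 4 * ((K : ℝ) + 1) / 2 ^ K * q * (1 / 4) := by ring
    _ ≤ _ := by gcongr

theorem integral_shiftedLog_sq_sech_bounds (K : ℕ) :
    0 ≤ (∫ x in Ioi (0 : ℝ), shiftedLog x ^ 2 * (1 / cosh x ^ 2)) -
        ∑ m ∈ Finset.range K, (eulerWeight K m : ℝ) * (π ^ 2 / 6 + log ((m : ℝ) + 1) ^ 2) ∧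
      (∫ x in Ioi (0 : ℝ), shiftedLog x ^ 2 * (1 / cosh x ^ 2)) -
        ∑ m ∈ Finset.range K, (eulerWeight K m : ℝ) * (π ^ 2 / 6 + log ((m : ℝ) + 1) ^ 2) ≤
        2 * ((K : ℝ) + 1) / 2 ^ K * (π ^ 2 / 6) := by
  have hf : ∀ n : ℕ, IntegrableOn (fun x => shiftedLog x ^ 2 * exp (-(2 * ((n : ℝ) + 1) * x)))
      (Ioi 0) ∧ ∫ x in Ioi (0 : ℝ), shiftedLog x ^ 2 * exp (-(2 * ((n : ℝ) + 1) * x)) =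
        (π ^ 2 / 6 + log ((n : ℝ) + 1) ^ 2) / (2 * ((n : ℝ) + 1)) :=
    fun n => integral_shiftedLog_sq_mul_exp (by positivity)
  have hsum : IntegrableOn (fun x => ∑ m ∈ Finset.range K, 2 * (eulerWeight K m : ℝ) *
      ((m : ℝ) + 1) * (shiftedLog x ^ 2 * exp (-(2 * ((m : ℝ) + 1) * x)))) (Ioi 0) :=
    integrable_finsetSum _ fun n _ => (hf n).1.const_mul _
  have e : ∀ x : ℝ, shiftedLog x ^ 2 * eulerRemainder K x =
      shiftedLog x ^ 2 * (1 / cosh x ^ 2) - ∑ m ∈ Finset.range K, 2 * (eulerWeight K m : ℝ) *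
        ((m : ℝ) + 1) * (shiftedLog x ^ 2 * exp (-(2 * ((m : ℝ) + 1) * x))) := by
    intro x
    rw [eulerRemainder, mul_sub, Finset.mul_sum]
    congr 1
    exact Finset.sum_congr rfl fun m _ => by ring
  have hval : ∫ x in Ioi (0 : ℝ), shiftedLog x ^ 2 * eulerRemainder K x =
      (∫ x in Ioi (0 : ℝ), shiftedLog x ^ 2 * (1 / cosh x ^ 2)) -
        ∑ m ∈ Finset.range K, (eulerWeight K m : ℝ) * (π ^ 2 / 6 + log ((m : ℝ) + 1) ^ 2) := by
    simp only [e]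
    rw [integral_sub integrableOn_shiftedLog_sq_sech hsum,
      integral_finsetSum _ fun n _ => (hf n).1.const_mul _]
    congr 1
    refine Finset.sum_congr rfl fun n _ => ?_
    have : (n : ℝ) + 1 ≠ 0 := by positivity
    rw [integral_const_mul, (hf n).2]
    field_simp
  have hi : IntegrableOn (fun x => shiftedLog x ^ 2 * eulerRemainder K x) (Ioi 0) := by
    simp only [e]; exact integrableOn_shiftedLog_sq_sech.sub hsum
  obtain ⟨i2, v2⟩ := integral_shiftedLog_sq_mul_exp one_pos
  rw [← hval]
  constructor
  · exact setIntegral_nonneg measurableSet_Ioi fun x hx =>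
      mul_nonneg (sq_nonneg _) (eulerRemainder_bounds K hx).1
  · have h := setIntegral_mono_on hi (i2.const_mul (4 * ((K : ℝ) + 1) / 2 ^ K)) measurableSet_Ioi
      fun x hx => by
        have h1 := mul_le_mul_of_nonneg_left (eulerRemainder_bounds K hx).2 (sq_nonneg (shiftedLog x))
        rw [mul_left_comm] at h1
        rwa [mul_one (2 : ℝ)]
    refine h.trans (le_of_eq ?_)
    rw [integral_const_mul, v2, log_one]
    ring

theorem integrableOn_log_sq_div_cosh_sq :
    IntegrableOn (fun x : ℝ => log x ^ 2 / cosh x ^ 2) (Ioi 0) ∧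
      ∫ x in Ioi (0 : ℝ), log x ^ 2 / cosh x ^ 2 =
        (∫ x in Ioi (0 : ℝ), shiftedLog x ^ 2 * (1 / cosh x ^ 2)) -
          2 * (log 2 + eulerMascheroniConstant) * log (π / 2) +
          (log 2 + eulerMascheroniConstant) ^ 2 := by
  set B := log 2 + eulerMascheroniConstant with hB
  have e : ∀ x : ℝ, log x ^ 2 / cosh x ^ 2 = shiftedLog x ^ 2 * (1 / cosh x ^ 2) -
      2 * B * (shiftedLog x * (1 / cosh x ^ 2)) + B ^ 2 * (1 / cosh x ^ 2) := by
    intro x; simp only [shiftedLog, ← hB]; ring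
  obtain ⟨i0, v0⟩ := integral_one_div_cosh_sq
  have i2 := integrableOn_shiftedLog_sq_sech
  have i1 := integrableOn_shiftedLog_sech.const_mul (2 * B)
  have i21 : IntegrableOn (fun x => shiftedLog x ^ 2 * (1 / cosh x ^ 2) -
      2 * B * (shiftedLog x * (1 / cosh x ^ 2))) (Ioi 0) := i2.sub i1
  simp only [e]
  refine ⟨i21.add (i0.const_mul _), ?_⟩
  rw [integral_add i21 (i0.const_mul _), integral_sub i2 i1, integral_const_mul, integral_const_mul,
    integral_shiftedLog_sech, v0, mul_one]

/-- The squares of `log 2` cancel, and with `B = log 2 + γ` the last term of `a₁` is `(B - log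
(π/2))²`, which absorbs the terms in `B` produced by centring the logarithm. -/
theorem a₁_eq : a₁ = log (π / 2) ^ 2 + π ^ 2 / 6 -
    ∫ x in Ioi (0 : ℝ), shiftedLog x ^ 2 * (1 / cosh x ^ 2) := by
  rw [a₁, integral_densityRemainder, integrableOn_log_sq_div_cosh_sq.2,
    log_div pi_ne_zero two_ne_zero]
  field_simp
  ring

/-! ### Rational enclosures of logarithms and the decimals of `a₁`. -/

theorem log_eq_of_one_sub {x ε : ℝ} (n : ℕ) (hx : 0 < x) (hx1 : x < 1)
    (h : x ^ (n + 1) / (1 - x) ≤ ε) :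
    |log (1 - x) + ∑ i ∈ Finset.range n, x ^ (i + 1) / ((i : ℝ) + 1)| ≤ ε := by
  have := abs_log_sub_add_sum_range_le (x := x) (by rwa [abs_of_pos hx]) n
  rw [abs_of_pos hx, add_comm] at this
  exact this.trans h

theorem abs_sq_sub_sq_le {x l : ℝ} (h : |x - l| ≤ 1 / 10 ^ 8) (h0 : 0 ≤ l) (h1 : l ≤ 4) :
    |x ^ 2 - l ^ 2| ≤ 1 / 10 ^ 7 := by
  rw [sq_sub_sq, abs_mul]
  have h2 : |x + l| ≤ 9 := by
    obtain ⟨h3, h4⟩ := abs_le.1 h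
    rw [abs_le]; constructor <;> linarith
  calc |x + l| * |x - l| ≤ 9 * (1 / 10 ^ 8) := by gcongr
    _ ≤ _ := by norm_num

/-- The ratio `7²/(2·5²) = 1 - 1/50` is a smooth number near 1, so a few terms of the series
suffice. The other primes use `99/100`, `50/51`, `360/361` and `1000/1001` in the same way. -/
theorem log_seven_bounds : |log 7 - 1.94591014906| ≤ 2 / 10 ^ 9 := by
  have h := log_eq_of_one_sub (x := 1 / 50) (ε := 1 / 10 ^ 9) 5 (by norm_num) (by norm_num)
    (by norm_num)
  have e : log (1 - 1 / 50) = 2 * log 7 - log 2 - 2 * log 5 := by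
    rw [show (1 : ℝ) - 1 / 50 = 7 ^ 2 / (2 * 5 ^ 2) by norm_num, log_div (by norm_num) (by norm_num),
      log_mul (by norm_num) (by norm_num), log_pow, log_pow]
    push_cast; ring
  rw [e] at h
  norm_num [Finset.sum_range_succ] at h
  have h2 := log_two_gt_d9; have h2' := log_two_lt_d9
  have h5 := log_five_gt_d9; have h5' := log_five_lt_d9
  rw [abs_le] at h ⊢
  constructor <;> linarith

theorem log_eleven_bounds : |log 11 - 2.39789527280| ≤ 2 / 10 ^ 9 := by
  have h := log_eq_of_one_sub (x := 1 / 100) (ε := 1 / 10 ^ 10) 5 (by norm_num) (by norm_num)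
    (by norm_num)
  have e : log (1 - 1 / 100) = log 11 + 2 * log 3 - 2 * log 2 - 2 * log 5 := by
    rw [show (1 : ℝ) - 1 / 100 = 11 * 3 ^ 2 / (2 ^ 2 * 5 ^ 2) by norm_num,
      log_div (by norm_num) (by norm_num), log_mul (by norm_num) (by norm_num),
      log_mul (by norm_num) (by norm_num), log_pow, log_pow, log_pow]
    push_cast; ring
  rw [e] at h
  norm_num [Finset.sum_range_succ] at h
  have h2 := log_two_gt_d9; have h2' := log_two_lt_d9
  have h3 := log_three_gt_d9; have h3' := log_three_lt_d9
  have h5 := log_five_gt_d9; have h5' := log_five_lt_d9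
  rw [abs_le] at h ⊢
  constructor <;> linarith

theorem log_seventeen_bounds : |log 17 - 2.83321334406| ≤ 5 / 10 ^ 9 := by
  have h := log_eq_of_one_sub (x := 1 / 51) (ε := 1 / 10 ^ 9) 5 (by norm_num) (by norm_num)
    (by norm_num)
  have e : log (1 - 1 / 51) = log 2 + 2 * log 5 - log 3 - log 17 := by
    rw [show (1 : ℝ) - 1 / 51 = 2 * 5 ^ 2 / (3 * 17) by norm_num,
      log_div (by norm_num) (by norm_num), log_mul (by norm_num) (by norm_num),
      log_mul (by norm_num) (by norm_num), log_pow]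
    push_cast; ring
  rw [e] at h
  norm_num [Finset.sum_range_succ] at h
  have h2 := log_two_gt_d9; have h2' := log_two_lt_d9
  have h3 := log_three_gt_d9; have h3' := log_three_lt_d9
  have h5 := log_five_gt_d9; have h5' := log_five_lt_d9
  rw [abs_le] at h ⊢
  constructor <;> linarith

theorem log_nineteen_bounds : |log 19 - 2.94443897917| ≤ 5 / 10 ^ 9 := by
  have h := log_eq_of_one_sub (x := 1 / 361) (ε := 1 / 10 ^ 9) 3 (by norm_num) (by norm_num)
    (by norm_num)
  have e : log (1 - 1 / 361) = 3 * log 2 + 2 * log 3 + log 5 - 2 * log 19 := by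
    rw [show (1 : ℝ) - 1 / 361 = 2 ^ 3 * 3 ^ 2 * 5 / 19 ^ 2 by norm_num,
      log_div (by norm_num) (by norm_num), log_mul (by norm_num) (by norm_num),
      log_mul (by norm_num) (by norm_num), log_pow, log_pow, log_pow]
    push_cast; ring
  rw [e] at h
  norm_num [Finset.sum_range_succ] at h
  have h2 := log_two_gt_d9; have h2' := log_two_lt_d9
  have h3 := log_three_gt_d9; have h3' := log_three_lt_d9
  have h5 := log_five_gt_d9; have h5' := log_five_lt_d9
  rw [abs_le] at h ⊢
  constructor <;> linarith

theorem log_thirteen_bounds : |log 13 - 2.56494935746| ≤ 9 / 10 ^ 9 := by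
  have h := log_eq_of_one_sub (x := 1 / 1001) (ε := 1 / 10 ^ 9) 2 (by norm_num) (by norm_num)
    (by norm_num)
  have e : log (1 - 1 / 1001) = 3 * log 2 + 3 * log 5 - log 7 - log 11 - log 13 := by
    rw [show (1 : ℝ) - 1 / 1001 = 2 ^ 3 * 5 ^ 3 / (7 * 11 * 13) by norm_num,
      log_div (by norm_num) (by norm_num), log_mul (by norm_num) (by norm_num),
      log_mul (by norm_num) (by norm_num), log_mul (by norm_num) (by norm_num), log_pow, log_pow]
    push_cast; ring
  rw [e] at h
  norm_num [Finset.sum_range_succ] at h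
  have h2 := log_two_gt_d9; have h2' := log_two_lt_d9
  have h5 := log_five_gt_d9; have h5' := log_five_lt_d9
  have h7 := abs_le.1 log_seven_bounds
  have h11 := abs_le.1 log_eleven_bounds
  rw [abs_le] at h ⊢
  constructor <;> linarith [h7.1, h7.2, h11.1, h11.2]

theorem log_pi_div_two_bounds : 0.4515823 ≤ log (π / 2) ∧ log (π / 2) ≤ 0.4515830 := by
  have h7 := abs_le.1 log_seven_bounds
  have h11 := abs_le.1 log_eleven_bounds
  have p1 := pi_gt_d6
  have p2 := pi_lt_d6
  -- The approximation `π ≈ 22/7` leaves a factor so close to 1 that the elementary bounds on `log`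
  -- suffice.
  have e : log (π / 2) = log 11 - log 7 + log (7 * π / 22) := by
    rw [show π / 2 = 11 / 7 * (7 * π / 22) by field_simp; norm_num,
      log_mul (by norm_num) (by positivity), log_div (by norm_num) (by norm_num)]
  have h1 := one_sub_inv_le_log_of_pos (by positivity : 0 < 7 * π / 22)
  have h2 := log_le_sub_one_of_pos (by positivity : 0 < 7 * π / 22)
  have h3 : (7 * π / 22)⁻¹ ≤ 1.0004028 := by
    rw [inv_le_iff_one_le_mul₀ (by positivity)]; linarith
  rw [e]
  constructor <;> linarith [h7.1, h7.2, h11.1, h11.2]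

/-- Approximations of `log (m + 1)` for `m < 22`. -/
def logApprox (m : ℕ) : ℚ :=
  ([0, 0.69314718056, 1.09861228867, 1.38629436112, 1.60943791243, 1.79175946923, 1.94591014906,
    2.07944154168, 2.19722457734, 2.30258509299, 2.39789527280, 2.48490664979, 2.56494935746,
    2.63905732962, 2.70805020110, 2.77258872224, 2.83321334406, 2.89037175790, 2.94443897917,
    2.99573227355, 3.04452243772, 3.09104245336] : List ℚ).getD m 0

theorem abs_log_sub_logApprox_le {m : ℕ} (hm : m < 22) :
    |log ((m : ℝ) + 1) - (logApprox m : ℝ)| ≤ 1 / 10 ^ 8 := by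
  have h2 := log_two_gt_d9; have h2' := log_two_lt_d9
  have h3 := log_three_gt_d9; have h3' := log_three_lt_d9
  have h5 := log_five_gt_d9; have h5' := log_five_lt_d9
  obtain ⟨h7, h7'⟩ := abs_le.1 log_seven_bounds
  obtain ⟨h11, h11'⟩ := abs_le.1 log_eleven_bounds
  obtain ⟨h13, h13'⟩ := abs_le.1 log_thirteen_bounds
  obtain ⟨h17, h17'⟩ := abs_le.1 log_seventeen_bounds
  obtain ⟨h19, h19'⟩ := abs_le.1 log_nineteen_bounds
  have e4 : log 4 = 2 * log 2 := by
    rw [show (4 : ℝ) = 2 ^ 2 by norm_num]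
    simp only [log_pow, Nat.cast_ofNat]
  have e6 : log 6 = log 2 + log 3 := by
    rw [show (6 : ℝ) = 2 * 3 by norm_num, log_mul (by norm_num) (by norm_num)]
  have e8 : log 8 = 3 * log 2 := by
    rw [show (8 : ℝ) = 2 ^ 3 by norm_num]
    simp only [log_pow, Nat.cast_ofNat]
  have e9 : log 9 = 2 * log 3 := by
    rw [show (9 : ℝ) = 3 ^ 2 by norm_num]
    simp only [log_pow, Nat.cast_ofNat]
  have e10 : log 10 = log 2 + log 5 := by
    rw [show (10 : ℝ) = 2 * 5 by norm_num, log_mul (by norm_num) (by norm_num)]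
  have e12 : log 12 = 2 * log 2 + log 3 := by
    rw [show (12 : ℝ) = 2 ^ 2 * 3 by norm_num, log_mul (by norm_num) (by norm_num)]
    simp only [log_pow, Nat.cast_ofNat]
  have e14 : log 14 = log 2 + log 7 := by
    rw [show (14 : ℝ) = 2 * 7 by norm_num, log_mul (by norm_num) (by norm_num)]
  have e15 : log 15 = log 3 + log 5 := by
    rw [show (15 : ℝ) = 3 * 5 by norm_num, log_mul (by norm_num) (by norm_num)]
  have e16 : log 16 = 4 * log 2 := by
    rw [show (16 : ℝ) = 2 ^ 4 by norm_num]
    simp only [log_pow, Nat.cast_ofNat]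
  have e18 : log 18 = log 2 + 2 * log 3 := by
    rw [show (18 : ℝ) = 2 * 3 ^ 2 by norm_num, log_mul (by norm_num) (by norm_num)]
    simp only [log_pow, Nat.cast_ofNat]
  have e20 : log 20 = 2 * log 2 + log 5 := by
    rw [show (20 : ℝ) = 2 ^ 2 * 5 by norm_num, log_mul (by norm_num) (by norm_num)]
    simp only [log_pow, Nat.cast_ofNat]
  have e21 : log 21 = log 3 + log 7 := by
    rw [show (21 : ℝ) = 3 * 7 by norm_num, log_mul (by norm_num) (by norm_num)]
  have e22 : log 22 = log 2 + log 11 := by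
    rw [show (22 : ℝ) = 2 * 11 by norm_num, log_mul (by norm_num) (by norm_num)]
  rw [abs_le]
  interval_cases m <;> norm_num [logApprox] <;>
    (try simp only [e4, e6, e8, e9, e10, e12, e14, e15, e16, e18, e20, e21, e22]) <;>
    constructor <;> linarith

theorem eulerWeight_sums :
    ∑ m ∈ Finset.range 22, eulerWeight 22 m = 1 - 1 / 2 ^ 22 ∧
      ∑ m ∈ Finset.range 22, |eulerWeight 22 m| ≤ 22 ∧
      |∑ m ∈ Finset.range 22, eulerWeight 22 m * logApprox m ^ 2 + 0.122059| ≤ 1 / 10 ^ 6 := by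
  refine ⟨?_, ?_, ?_⟩ <;> decide +kernel

theorem logApprox_bounds {m : ℕ} (hm : m < 22) : 0 ≤ logApprox m ∧ logApprox m ≤ 4 := by
  have : ∀ m < 22, 0 ≤ logApprox m ∧ logApprox m ≤ 4 := by decide +kernel
  exact this m hm

theorem abs_sum_eulerWeight_log_sq_le :
    |∑ m ∈ Finset.range 22, (eulerWeight 22 m : ℝ) * log ((m : ℝ) + 1) ^ 2 + 0.122059| ≤
      4 / 10 ^ 6 := by
  obtain ⟨-, h2, h3⟩ := eulerWeight_sums
  have h2' : ∑ m ∈ Finset.range 22, |(eulerWeight 22 m : ℝ)| ≤ 22 := by exact_mod_cast h2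
  have h3' : |∑ m ∈ Finset.range 22, (eulerWeight 22 m : ℝ) * (logApprox m : ℝ) ^ 2 + 0.122059| ≤
      1 / 10 ^ 6 := by
    have := (Rat.cast_le (K := ℝ)).2 h3
    push_cast at this
    exact this
  have h4 : |∑ m ∈ Finset.range 22, (eulerWeight 22 m : ℝ) *
      (log ((m : ℝ) + 1) ^ 2 - (logApprox m : ℝ) ^ 2)| ≤ 22 * (1 / 10 ^ 7) := by
    refine (Finset.abs_sum_le_sum_abs _ _).trans ?_
    calc _ ≤ ∑ m ∈ Finset.range 22, |(eulerWeight 22 m : ℝ)| * (1 / 10 ^ 7) := by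
          refine Finset.sum_le_sum fun m hm => ?_
          have hm := Finset.mem_range.1 hm
          rw [abs_mul]
          refine mul_le_mul_of_nonneg_left ?_ (abs_nonneg _)
          obtain ⟨b1, b2⟩ := logApprox_bounds hm
          exact abs_sq_sub_sq_le (abs_log_sub_logApprox_le hm) (by exact_mod_cast b1)
            (by exact_mod_cast b2)
      _ ≤ _ := by
          rw [← Finset.sum_mul]
          exact mul_le_mul_of_nonneg_right h2' (by norm_num)
  simp only [mul_sub, Finset.sum_sub_distrib] at h4
  rw [abs_le] at h3' h4 ⊢
  constructor <;> linarith

/-- With 22 terms the one-sided truncation error is below `2·10⁻⁵`. The other terms give about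
`0.203927 + 0.122059 = 0.325986`, with errors of a few `10⁻⁶`. -/
theorem abs_a₁_sub_le : |a₁ - 0.3260| ≤ 0.00005 := by
  obtain ⟨ha, hb⟩ := integral_shiftedLog_sq_sech_bounds 22
  have hw : ∑ m ∈ Finset.range 22, (eulerWeight 22 m : ℝ) = 1 - 1 / 2 ^ 22 := by
    have := congrArg (Rat.cast : ℚ → ℝ) eulerWeight_sums.1
    push_cast at this
    exact this
  simp only [mul_add, Finset.sum_add_distrib, ← Finset.sum_mul, hw] at ha hb
  have hs := abs_le.1 abs_sum_eulerWeight_log_sq_le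
  rw [a₁_eq]
  have p3 : π ^ 2 / 6 ≤ 1.645 := by nlinarith [pi_gt_d6, pi_lt_d6]
  have p4 : 0 ≤ π ^ 2 / 6 := by positivity
  obtain ⟨q1, q2⟩ := log_pi_div_two_bounds
  have q3 : 0.203926 ≤ log (π / 2) ^ 2 := by nlinarith
  have q4 : log (π / 2) ^ 2 ≤ 0.203928 := by nlinarith
  norm_num at ha hb
  rw [abs_le]
  constructor <;> norm_num <;> linarith [hs.1, hs.2]

/-! ### The gap integral and its asymptotic expansion -/

theorem strictMono_tanh : StrictMono tanh :=
  strictMono_of_hasDerivAt_pos hasDerivAt_tanh fun x => by positivity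

theorem abs_tanh_sub_tanh_le (x y : ℝ) : |tanh x - tanh y| ≤ |x - y| := by
  have h := Convex.norm_image_sub_le_of_norm_hasDerivWithin_le (f := tanh) (C := 1) (s := univ)
    (fun z _ => (hasDerivAt_tanh z).hasDerivWithinAt) (fun z _ => by
      rw [Real.norm_of_nonneg (by positivity), div_le_one (by positivity)]
      exact one_le_pow₀ (one_le_cosh z)) convex_univ (mem_univ y) (mem_univ x)
  simpa using h

theorem tanh_nonneg_of_nonneg {x : ℝ} (hx : 0 ≤ x) : 0 ≤ tanh x := by
  rw [← tanh_zero]; exact strictMono_tanh.monotone hx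

theorem tanh_le_self {x : ℝ} (hx : 0 ≤ x) : tanh x ≤ x := by
  have h := abs_tanh_sub_tanh_le x 0
  rw [tanh_zero, sub_zero, sub_zero, abs_of_nonneg hx] at h
  exact (le_abs_self _).trans h

theorem one_sub_tanh_bounds (x : ℝ) : 0 ≤ 1 - tanh x ∧ 1 - tanh x ≤ 2 * exp (-(2 * x)) := by
  rw [tanh_eq_exp]
  have := exp_pos (-(2 * x))
  constructor
  · rw [sub_sub_cancel]; positivity
  · rw [sub_sub_cancel]; exact div_le_self (by positivity) (by linarith)

@[fun_prop]
theorem measurable_tanh : Measurable tanh := continuous_tanh.measurable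

/-- The integral that determines the Néel temperature `T`, at `a = 2 / T`. -/
def gapIntegral (a : ℝ) : ℝ := ∫ u in Ioo 0 1, ellipticK u * (tanh (a * u) / u)

theorem abs_tanh_mul_div_le (a : ℝ) {u : ℝ} (hu : 0 < u) : |tanh (a * u) / u| ≤ |a| := by
  have h := abs_tanh_sub_tanh_le (a * u) 0
  rw [tanh_zero, sub_zero, sub_zero, abs_mul, abs_of_pos hu] at h
  rwa [abs_div, abs_of_pos hu, div_le_iff₀ hu]

theorem integrableOn_gap (a : ℝ) :
    IntegrableOn (fun u => ellipticK u * (tanh (a * u) / u)) (Ioo 0 1) := by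
  refine Integrable.mono' (integrableOn_ellipticK.mul_const |a|)
    (Measurable.aestronglyMeasurable (by fun_prop)) ?_
  filter_upwards [ae_restrict_mem measurableSet_Ioo] with u hu
  rw [norm_mul, Real.norm_of_nonneg (ellipticK_nonneg u)]
  exact mul_le_mul_of_nonneg_left (abs_tanh_mul_div_le a hu.1) (ellipticK_nonneg u)

theorem exp_neg_le_two_div_sq {a : ℝ} (ha : 0 < a) : exp (-a) ≤ 2 / a ^ 2 := by
  have h := quadratic_le_exp_of_nonneg ha.le
  rw [exp_neg, inv_le_comm₀ (exp_pos _) (by positivity), inv_div]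
  linarith

/-- The leading term `log (32 e^γ / (π T))` at `a = 2 / T`. -/
def gapLog (a : ℝ) : ℝ := log (4 * a) + (log 2 + eulerMascheroniConstant) - log (π / 2)

/-- With `B = log 2 + γ`, write `L - log x = (L + B) - shiftedLog x`. The moments of `1/cosh²` then
complete the square around `log (π/2)`, and the leftover constant is `π²/6 - a₁`. -/
theorem integral_log_sub_sq_sech (L : ℝ) :
    IntegrableOn (fun x : ℝ => (L - log x) ^ 2 * (1 / cosh x ^ 2)) (Ioi 0) ∧
      ∫ x in Ioi (0 : ℝ), (L - log x) ^ 2 * (1 / cosh x ^ 2) =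
        (L + (log 2 + eulerMascheroniConstant) - log (π / 2)) ^ 2 - a₁ + π ^ 2 / 6 := by
  set B := log 2 + eulerMascheroniConstant with hB
  have e : ∀ x : ℝ, (L - log x) ^ 2 * (1 / cosh x ^ 2) = shiftedLog x ^ 2 * (1 / cosh x ^ 2) -
      2 * (L + B) * (shiftedLog x * (1 / cosh x ^ 2)) + (L + B) ^ 2 * (1 / cosh x ^ 2) := by
    intro x; simp only [shiftedLog, ← hB]; ring
  obtain ⟨i0, v0⟩ := integral_one_div_cosh_sq
  have i2 := integrableOn_shiftedLog_sq_sech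
  have i1 := integrableOn_shiftedLog_sech.const_mul (2 * (L + B))
  have i21 : IntegrableOn (fun x => shiftedLog x ^ 2 * (1 / cosh x ^ 2) -
      2 * (L + B) * (shiftedLog x * (1 / cosh x ^ 2))) (Ioi 0) := i2.sub i1
  simp only [e]
  refine ⟨i21.add (i0.const_mul _), ?_⟩
  rw [integral_add i21 (i0.const_mul _), integral_sub i2 i1, integral_const_mul, integral_const_mul,
    integral_shiftedLog_sech, v0, mul_one, a₁_eq]
  ring

theorem intervalIntegrable_log_tanh_div (L : ℝ) {a : ℝ} (ha : 0 < a) :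
    IntervalIntegrable (fun x => (L - log x) * (tanh x / x)) volume 0 a := by
  have h1 : IntervalIntegrable (fun x => L - log x) volume 0 a :=
    intervalIntegrable_const.sub intervalIntegral.intervalIntegrable_log'
  rw [intervalIntegrable_iff_integrableOn_Ioc_of_le ha.le] at h1 ⊢
  refine Integrable.mono h1 (Measurable.aestronglyMeasurable (by fun_prop)) ?_
  filter_upwards [ae_restrict_mem measurableSet_Ioc] with x hx
  rw [norm_mul]
  refine mul_le_of_le_one_right (norm_nonneg _) ?_
  have h := abs_tanh_mul_div_le 1 hx.1
  rw [one_mul, abs_one] at h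
  exact h

/-- Integration by parts against `d(-(L - log x)²/2)`, which moves the derivative onto `tanh`. -/
theorem integral_log_tanh_div (L : ℝ) {a : ℝ} (ha : 0 < a) :
    ∫ x in (0 : ℝ)..a, (L - log x) * (tanh x / x) =
      -(1 / 2 * (L - log a) ^ 2 * tanh a) +
        1 / 2 * ∫ x in Ioc 0 a, (L - log x) ^ 2 * (1 / cosh x ^ 2) := by
  have h1 := intervalIntegrable_log_tanh_div L ha
  have h2 : IntervalIntegrable (fun x : ℝ => 1 / 2 * ((L - log x) ^ 2 * (1 / cosh x ^ 2)))
      volume 0 a := by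
    rw [intervalIntegrable_iff_integrableOn_Ioc_of_le ha.le]
    exact ((integral_log_sub_sq_sech L).1.mono_set Ioc_subset_Ioi_self).const_mul _
  have hd : ∀ x ∈ Ioo 0 a, HasDerivAt (fun x => -(1 / 2 * (L - log x) ^ 2 * tanh x))
      ((L - log x) * (tanh x / x) - 1 / 2 * ((L - log x) ^ 2 * (1 / cosh x ^ 2))) x := by
    intro x hx
    have hx0 : x ≠ 0 := hx.1.ne'
    have d1 := ((((hasDerivAt_log hx0).const_sub L).pow 2).const_mul (1 / 2)).mul (hasDerivAt_tanh x)
    refine d1.neg.congr_deriv ?_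
    simp
    field_simp
    ring
  -- The boundary term vanishes because `tanh x ≤ x` and `√x log x → 0`.
  have hlim0 : Tendsto (fun x => -(1 / 2 * (L - log x) ^ 2 * tanh x)) (𝓝[>] 0) (𝓝 0) := by
    have t1 : Tendsto (fun x : ℝ => x ^ (1 / 2 : ℝ)) (𝓝[>] 0) (𝓝 0) := by
      have : ContinuousAt (fun x : ℝ => x ^ (1 / 2 : ℝ)) 0 :=
        continuousAt_rpow_const _ _ (Or.inr (by norm_num))
      have h := this.tendsto.mono_left (nhdsWithin_le_nhds (s := Ioi 0))
      rwa [zero_rpow (by norm_num)] at h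
    have t2 := tendsto_log_mul_rpow_nhdsGT_zero (by norm_num : (0 : ℝ) < 1 / 2)
    have t3 : Tendsto (fun x : ℝ => 1 / 2 * (L * x ^ (1 / 2 : ℝ) - log x * x ^ (1 / 2 : ℝ)) ^ 2)
        (𝓝[>] 0) (𝓝 0) := by
      have h := (((t1.const_mul L).sub t2).pow 2).const_mul (1 / 2)
      rwa [show 1 / 2 * (L * 0 - 0) ^ 2 = (0 : ℝ) by ring] at h
    refine squeeze_zero_norm' ?_ t3
    filter_upwards [self_mem_nhdsWithin] with x hx
    have hx : 0 < x := hx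
    have hs : (x ^ (1 / 2 : ℝ)) ^ 2 = x := by
      rw [← rpow_natCast, ← rpow_mul hx.le]; norm_num
    have ht := tanh_le_self hx.le
    have ht0 := tanh_nonneg_of_nonneg hx.le
    rw [norm_neg, Real.norm_of_nonneg (by positivity), ← sub_mul, mul_pow, hs, mul_assoc]
    gcongr
  have hlima : Tendsto (fun x => -(1 / 2 * (L - log x) ^ 2 * tanh x)) (𝓝[<] a)
      (𝓝 (-(1 / 2 * (L - log a) ^ 2 * tanh a))) := by
    have : ContinuousAt (fun x => -(1 / 2 * (L - log x) ^ 2 * tanh x)) a :=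
      ((continuousAt_const.mul ((continuousAt_const.sub (continuousAt_log ha.ne')).pow 2)).mul
        continuous_tanh.continuousAt).neg
    exact this.tendsto.mono_left nhdsWithin_le_nhds
  have h := intervalIntegral.integral_eq_sub_of_hasDerivAt_of_tendsto ha hd (h1.sub h2) hlim0 hlima
  rw [intervalIntegral.integral_sub h1 h2, intervalIntegral.integral_const_mul, sub_zero] at h
  rw [← intervalIntegral.integral_of_le ha.le]
  linarith

/-- For `x > a ≥ 1` one has `|log (4a/x)| ≤ 2x`. The bound `x² e^(-x) ≤ 2` then reduces the
integrand to `32 e^(-x)`, and `e^(-a) ≤ 2/a²` finishes. -/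
theorem integral_tail_log_sech_le {a : ℝ} (ha : 1 ≤ a) :
    0 ≤ ∫ x in Ioi a, (log (4 * a) - log x) ^ 2 * (1 / cosh x ^ 2) ∧
      ∫ x in Ioi a, (log (4 * a) - log x) ^ 2 * (1 / cosh x ^ 2) ≤ 64 / a ^ 2 := by
  have ha0 : 0 < a := by linarith
  refine ⟨setIntegral_nonneg measurableSet_Ioi fun x _ => by positivity, ?_⟩
  have hi := (integral_log_sub_sq_sech (log (4 * a))).1.mono_set (Ioi_subset_Ioi ha0.le)
  have h : ∀ x ∈ Ioi a, (log (4 * a) - log x) ^ 2 * (1 / cosh x ^ 2) ≤ 32 * exp (-x) := by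
    intro x hx
    have hx : a < x := hx
    have hx0 : 0 < x := by linarith
    have h1 : |log (4 * a) - log x| ≤ 2 * x := by
      rw [← log_div (by positivity) hx0.ne', abs_le]
      have e1 := one_sub_inv_le_log_of_pos (by positivity : 0 < 4 * a / x)
      have e2 := log_le_sub_one_of_pos (by positivity : 0 < 4 * a / x)
      have e3 : (4 * a / x)⁻¹ ≤ x := by
        rw [inv_div, div_le_iff₀ (by positivity)]; nlinarith
      have e4 : 4 * a / x ≤ 4 := by rw [div_le_iff₀ hx0]; nlinarith
      have e5 : log (4 * a / x) ≤ log 4 := log_le_log (by positivity) e4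
      have e6 : log 4 ≤ 2 := by
        rw [show (4 : ℝ) = 2 ^ 2 by norm_num, log_pow]; push_cast
        linarith [log_two_lt_d9]
      constructor <;> linarith
    have h2 : (log (4 * a) - log x) ^ 2 ≤ (2 * x) ^ 2 := sq_le_sq' (by linarith [abs_le.1 h1]) (abs_le.1 h1).2
    have h3 := one_div_cosh_sq_le x
    have h4 : exp (-(2 * x)) = exp (-x) * exp (-x) := by rw [← exp_add]; ring_nf
    have h5 := exp_neg_le_two_div_sq hx0
    rw [le_div_iff₀ (by positivity)] at h5
    have h6 := exp_pos (-x)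
    calc _ ≤ (2 * x) ^ 2 * (4 * exp (-(2 * x))) := by gcongr
      _ = 16 * (exp (-x) * x ^ 2) * exp (-x) := by rw [h4]; ring
      _ ≤ 16 * 2 * exp (-x) := by gcongr
      _ = _ := by ring
  refine (setIntegral_mono_on hi ((integrableOn_exp_neg_Ioi a).const_mul 32) measurableSet_Ioi
    h).trans ?_
  rw [integral_const_mul, integral_exp_neg_Ioi]
  have := exp_neg_le_two_div_sq ha0
  calc _ ≤ 32 * (2 / a ^ 2) := by gcongr
    _ = _ := by ring

theorem log_four_mul_le_gapLog (a : ℝ) : log (4 * a) ≤ gapLog a := by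
  have h1 := one_half_lt_eulerMascheroniConstant
  have h2 := log_two_gt_d9
  have h3 := log_pi_div_two_bounds.2
  rw [gapLog]; linarith

theorem one_le_gapLog {a : ℝ} (ha : 1 ≤ a) : 1 ≤ gapLog a := by
  refine le_trans ?_ (log_four_mul_le_gapLog a)
  have : log 4 ≤ log (4 * a) := log_le_log (by norm_num) (by linarith)
  have h2 : log 4 = 2 * log 2 := by
    rw [show (4 : ℝ) = 2 ^ 2 by norm_num, log_pow]; norm_num
  linarith [log_two_gt_d9]

/-- The cut-off `1 - tanh(au)` restricts the integral to `u ~ 1/a`, where `R(u)/u` is of order `u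
log (4/u)`. The result is of order `log(4a)/a²`, and `log(4a) ≤ gapLog a`. -/
theorem exists_remainder_bound : ∃ C : ℝ, ∀ a : ℝ, 1 ≤ a →
    |∫ u in Ioo 0 1, logRemainder u / u * (1 - tanh (a * u))| ≤ C * gapLog a / a ^ 2 := by
  set I := ∫ u in Ioo 0 1, (2 + ellipticK u) with hI
  have hK : IntegrableOn (fun u => 2 + ellipticK u) (Ioo 0 1) :=
    (integrable_const 2).add integrableOn_ellipticK
  have hI0 : 0 ≤ I := setIntegral_nonneg measurableSet_Ioo fun u _ => by
    have := ellipticK_nonneg u; linarith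
  refine ⟨12 + 4 * I, fun a ha => ?_⟩
  have ha0 : 0 < a := by linarith
  have hY := one_le_gapLog ha
  set l := log (4 * a) with hl
  have hl0 : 0 ≤ l := log_nonneg (by linarith)
  have hb : ∀ᵐ u ∂volume.restrict (Ioo (0 : ℝ) 1), ‖logRemainder u / u * (1 - tanh (a * u))‖ ≤
      (8 + 4 * l) / a * exp (-a * u) + 2 * exp (-a) * (2 + ellipticK u) := by
    filter_upwards [ae_abs_logRemainder_le, ae_ellipticK_le, ae_restrict_mem measurableSet_Ioo]
      with u h1 h2 hu
    obtain ⟨t1, t2⟩ := one_sub_tanh_bounds (a * u)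
    have hu0 := hu.1
    have hk := ellipticK_nonneg u
    have hE := exp_pos (-a * u)
    have e1 : ‖logRemainder u / u * (1 - tanh (a * u))‖ ≤
        u * (2 + ellipticK u) * (2 * exp (-(2 * (a * u)))) := by
      rw [norm_mul, Real.norm_of_nonneg t1, norm_div, Real.norm_of_nonneg hu0.le]
      refine mul_le_mul ?_ t2 t1 (by positivity)
      rw [div_le_iff₀ hu0, Real.norm_eq_abs]
      calc _ ≤ _ := h1
        _ = _ := by ring
    refine e1.trans ?_
    -- For `u ≤ 1/2` the logarithmic bound on `K` is available; one factor `e^(-au)` absorbs `u`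
    -- into `1/a` and the other is kept for the integration. For `u > 1/2` the exponential is at
    -- most `e^(-a)`, and integrability of `K` suffices.
    rcases le_or_gt u (1 / 2) with hh | hh
    · have h3 := h2 hh
      have h4 : log (4 / u) ≤ l + 1 / (a * u) := by
        have h5 : log (4 / u) = l + log (1 / (a * u)) := by
          rw [hl, ← log_mul (by positivity) (by positivity)]; congr 1; field_simp
        have h6 := log_le_sub_one_of_pos (by positivity : 0 < 1 / (a * u))
        linarith
      have h5 : exp (-(2 * (a * u))) = exp (-a * u) * exp (-a * u) := by
        rw [← exp_add]; ring_nf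
      have h6 : a * u * exp (-a * u) ≤ 1 := by
        have := add_one_le_exp (a * u)
        rw [neg_mul, exp_neg, ← div_eq_mul_inv, div_le_one (exp_pos _)]; linarith
      have h7 : exp (-a * u) ≤ 1 := by
        rw [exp_le_one_iff]; nlinarith
      have h8 : u * (2 + ellipticK u) ≤ (2 + 2 * l) * u + 2 / a := by
        have : u * ellipticK u ≤ u * (2 * (l + 1 / (a * u))) := by gcongr; linarith
        have e : u * (2 * (l + 1 / (a * u))) = 2 * l * u + 2 / a := by field_simp
        linarith
      have h9 : u * exp (-a * u) ≤ 1 / a := by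
        rw [le_div_iff₀ ha0]; linarith
      have hp : 0 ≤ 2 * exp (-a) * (2 + ellipticK u) := by positivity
      have h10 : ((2 + 2 * l) * u + 2 / a) * exp (-a * u) ≤ (4 + 2 * l) / a := by
        have e2 : (2 + 2 * l) * (u * exp (-a * u)) ≤ (2 + 2 * l) * (1 / a) := by gcongr
        have e3 : 2 / a * exp (-a * u) ≤ 2 / a * 1 := by gcongr
        have e4 : (4 + 2 * l) / a = (2 + 2 * l) * (1 / a) + 2 / a * 1 := by ring
        rw [e4]; linarith
      calc u * (2 + ellipticK u) * (2 * exp (-(2 * (a * u))))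
          ≤ ((2 + 2 * l) * u + 2 / a) * (2 * exp (-(2 * (a * u)))) := by gcongr
        _ = 2 * (((2 + 2 * l) * u + 2 / a) * exp (-a * u)) * exp (-a * u) := by rw [h5]; ring
        _ ≤ 2 * ((4 + 2 * l) / a) * exp (-a * u) := by gcongr
        _ = (8 + 4 * l) / a * exp (-a * u) := by ring
        _ ≤ _ := by linarith
    · have h3 : exp (-(2 * (a * u))) ≤ exp (-a) := exp_le_exp.2 (by nlinarith)
      have hp : 0 ≤ (8 + 4 * l) / a * exp (-a * u) := by positivity
      calc u * (2 + ellipticK u) * (2 * exp (-(2 * (a * u))))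
          ≤ 1 * (2 + ellipticK u) * (2 * exp (-a)) := by gcongr; exact hu.2.le
        _ = 2 * exp (-a) * (2 + ellipticK u) := by ring
        _ ≤ _ := by linarith
  have hie : IntegrableOn (fun u => (8 + 4 * l) / a * exp (-a * u)) (Ioi 0) :=
    (integrableOn_exp_mul_Ioi (neg_lt_zero.2 ha0) 0).const_mul _
  have hie' := hie.mono_set (fun x (hx : x ∈ Ioo (0 : ℝ) 1) => mem_Ioi.2 hx.1)
  have h1 := norm_integral_le_of_norm_le (hie'.add (hK.const_mul (2 * exp (-a)))) hb
  rw [Real.norm_eq_abs] at h1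
  refine h1.trans ?_
  have h2 : ∫ u in Ioo 0 1, (8 + 4 * l) / a * exp (-a * u) ≤ (8 + 4 * l) / a ^ 2 := by
    refine (setIntegral_mono_set hie ?_ Ioo_subset_Ioi_self.eventuallyLE).trans ?_
    · filter_upwards with u
      simp only [Pi.zero_apply]; positivity
    · rw [integral_const_mul, integral_exp_mul_Ioi (neg_lt_zero.2 ha0)]
      refine le_of_eq ?_
      simp; field_simp
  simp only [Pi.add_apply]
  rw [integral_add hie' (hK.const_mul _), integral_const_mul (2 * exp (-a)), ← hI]
  have h3 := exp_neg_le_two_div_sq ha0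
  have h4 : 2 * exp (-a) * I ≤ 2 * (2 / a ^ 2) * I := by gcongr
  have h5 := log_four_mul_le_gapLog a
  calc _ ≤ (8 + 4 * l) / a ^ 2 + 2 * (2 / a ^ 2) * I := add_le_add h2 h4
    _ = (8 + 4 * l + 4 * I) / a ^ 2 := by ring
    _ ≤ _ := by gcongr; nlinarith

/-- The asymptotic expansion of the gap integral at low temperature. -/
theorem exists_gapIntegral_bound : ∃ C : ℝ, 0 < C ∧ ∀ a : ℝ, 1 ≤ a →
    |2 * gapIntegral a - (gapLog a ^ 2 - a₁)| ≤ C * gapLog a / a ^ 2 := by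
  obtain ⟨C, hC⟩ := exists_remainder_bound
  refine ⟨2 * |C| + 80, by positivity, fun a ha => ?_⟩
  have ha0 : 0 < a := by linarith
  have hY := one_le_gapLog ha
  set E := ∫ u in Ioo 0 1, logRemainder u / u * (1 - tanh (a * u)) with hE
  set t := ∫ x in Ioi a, (log (4 * a) - log x) ^ 2 * (1 / cosh x ^ 2) with ht
  obtain ⟨t0, t1⟩ := integral_tail_log_sech_le ha
  rw [← ht] at t0 t1
  obtain ⟨i2, v2⟩ := integral_log_sub_sq_sech (log (4 * a))
  have hsplit : ∫ x in Ioc 0 a, (log (4 * a) - log x) ^ 2 * (1 / cosh x ^ 2) =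
      gapLog a ^ 2 - a₁ + π ^ 2 / 6 - t := by
    have h := setIntegral_union (Ioc_disjoint_Ioi_same (a := (0 : ℝ)) (b := a)) measurableSet_Ioi
      (i2.mono_set Ioc_subset_Ioi_self) (i2.mono_set (Ioi_subset_Ioi ha0.le))
    rw [Ioc_union_Ioi_eq_Ioi ha0.le, v2] at h
    rw [gapLog]; linarith
  have hA : ∫ u in Ioo 0 1, log (4 / u) * (tanh (a * u) / u) =
      ∫ x in (0 : ℝ)..a, (log (4 * a) - log x) * (tanh x / x) := by
    have h := intervalIntegral.mul_integral_comp_mul_left (a := 0) (b := 1) a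
      (f := fun x => (log (4 * a) - log x) * (tanh x / x))
    rw [mul_zero, mul_one] at h
    rw [← h, intervalIntegral.integral_of_le zero_le_one, integral_Ioc_eq_integral_Ioo,
      ← integral_const_mul]
    refine setIntegral_congr_fun measurableSet_Ioo fun u hu => ?_
    have hu0 := hu.1
    have : log (4 / u) = log (4 * a) - log (a * u) := by
      rw [← log_div (by positivity) (by positivity)]; congr 1; field_simp
    simp only [this]
    field_simp
  have hAi : IntegrableOn (fun u => log (4 / u) * (tanh (a * u) / u)) (Ioo 0 1) := by
    have h : IntegrableOn (fun u => logRemainder u * (tanh (a * u) / u)) (Ioo 0 1) := by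
      refine Integrable.mono integrableOn_logRemainder_div
        (Measurable.aestronglyMeasurable (by fun_prop)) ?_
      filter_upwards with u
      rw [norm_mul, norm_div, norm_div, ← mul_div_assoc]
      refine div_le_div_of_nonneg_right (mul_le_of_le_one_right (norm_nonneg _) ?_) (norm_nonneg _)
      exact (abs_tanh_lt_one _).le
    refine ((integrableOn_gap a).sub h).congr_fun (fun u _ => ?_) measurableSet_Ioo
    simp only [logRemainder, Pi.sub_apply]; ring
  have hEi : IntegrableOn (fun u => logRemainder u / u * (1 - tanh (a * u))) (Ioo 0 1) := by
    refine Integrable.mono (integrableOn_logRemainder_div.mul_const 2)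
      (Measurable.aestronglyMeasurable (by fun_prop)) ?_
    filter_upwards with u
    rw [norm_mul, norm_mul]
    refine mul_le_mul_of_nonneg_left ?_ (norm_nonneg _)
    have := abs_lt.1 (abs_tanh_lt_one (a * u))
    rw [Real.norm_eq_abs, Real.norm_eq_abs, abs_of_pos (by linarith), abs_of_pos two_pos]
    linarith
  have hsumi : IntegrableOn (fun u => log (4 / u) * (tanh (a * u) / u) + logRemainder u / u)
      (Ioo 0 1) := hAi.add integrableOn_logRemainder_div
  have hG : gapIntegral a = (∫ u in Ioo 0 1, log (4 / u) * (tanh (a * u) / u)) +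
      (2 * log 2 ^ 2 - π ^ 2 / 12) - E := by
    rw [← integral_logRemainder_div, gapIntegral, hE, ← integral_add hAi integrableOn_logRemainder_div,
      ← integral_sub hsumi hEi]
    refine setIntegral_congr_fun measurableSet_Ioo fun u _ => ?_
    simp only [logRemainder]; ring
  have hlog : log (4 * a) - log a = 2 * log 2 := by
    rw [log_mul (by norm_num) ha0.ne', show (4 : ℝ) = 2 ^ 2 by norm_num, log_pow]; push_cast; ring
  rw [hA, integral_log_tanh_div _ ha0, hsplit, hlog] at hG
  -- The constant `π²/6` from the moments cancels twice the `-π²/12` from the remainder. Likewise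
  -- twice `2 log² 2` cancels the boundary term, up to the factor `tanh a`.
  have hkey : 2 * gapIntegral a - (gapLog a ^ 2 - a₁) =
      4 * log 2 ^ 2 * (1 - tanh a) - t - 2 * E := by rw [hG]; ring
  obtain ⟨s0, s1⟩ := one_sub_tanh_bounds a
  have hE1 := hC a ha
  rw [← hE] at hE1
  have hE2 : |E| ≤ |C| * gapLog a / a ^ 2 :=
    hE1.trans (by gcongr; exact le_abs_self C)
  have s2 : 4 * log 2 ^ 2 * (1 - tanh a) ≤ 16 / a ^ 2 := by
    have h1 : exp (-(2 * a)) ≤ exp (-a) := exp_le_exp.2 (by linarith)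
    have h2 := exp_neg_le_two_div_sq ha0
    have h3 : log 2 ^ 2 ≤ 1 := by nlinarith [log_two_gt_d9, log_two_lt_d9]
    have h4 : 1 - tanh a ≤ 2 * (2 / a ^ 2) := by linarith
    calc _ ≤ 4 * 1 * (2 * (2 / a ^ 2)) := by gcongr
      _ = _ := by ring
  have s3 : 0 ≤ 4 * log 2 ^ 2 * (1 - tanh a) := by positivity
  have s4 : 80 / a ^ 2 ≤ 80 * gapLog a / a ^ 2 := by gcongr; linarith
  have s5 : (2 * |C| + 80) * gapLog a / a ^ 2 =
      2 * (|C| * gapLog a / a ^ 2) + 80 * gapLog a / a ^ 2 := by ring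
  have s6 : (80 : ℝ) / a ^ 2 = 16 / a ^ 2 + 64 / a ^ 2 := by ring
  rw [hkey, s5, abs_le]
  obtain ⟨e1, e2⟩ := abs_le.1 hE2
  constructor <;> linarith

/-! ### Existence, uniqueness and asymptotics of the Néel temperature -/

/-- The integrand is nonnegative and even in `ε`, so the law of `|ε|` suffices and the computation
can be made with lower integrals, without prior integrability. -/
theorem integral_gapEquation {U T : ℝ} (hU : 0 < U) (hT : 0 < T) :
    ∫ k, U * tanh (band 0 k / (2 * T)) / (2 * band 0 k) ∂momentumMeasure =
      U / (2 * π ^ 2) * gapIntegral (2 / T) := by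
  set F : ℝ → ℝ := fun ε => U * tanh (ε / (2 * T)) / (2 * ε) with hF
  have hFm : Measurable F := by fun_prop
  have hband : Measurable (band 0) := by unfold band; fun_prop
  have habs : ∀ ε, F |ε| = F ε := by
    intro ε
    rcases abs_choice ε with h | h
    · rw [h]
    · rw [h]; simp only [hF, neg_div, div_neg, tanh_neg, mul_neg, neg_neg]
  have hnn : ∀ ε, 0 ≤ F ε := by
    intro ε
    rw [← habs]
    have := tanh_nonneg_of_nonneg (by positivity : 0 ≤ |ε| / (2 * T))
    simp only [hF]; positivity
  have h1 : ∫⁻ k, ENNReal.ofReal (F (band 0 k)) ∂momentumMeasure =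
      ENNReal.ofReal (4 / π ^ 2) *
        ∫⁻ u in Ioi 0, ENNReal.ofReal (F (4 * u)) * bandKernel u := by
    rw [← lintegral_bandEnergyLaw_abs hFm.ennreal_ofReal, bandEnergyLaw,
      lintegral_map (by fun_prop) hband]
    simp only [habs]
  have h2 : ∫⁻ u in Ioi 0, ENNReal.ofReal (F (4 * u)) * bandKernel u =
      ∫⁻ u in Ioo 0 1, ENNReal.ofReal (U / 8 * (ellipticK u * (tanh (2 / T * u) / u))) := by
    rw [setLIntegral_Ioi_eq_Ioo (u := 0) (v := 1) le_rfl fun x hx0 hx => by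
      rcases hx with hx | hx
      · exact absurd hx0 hx.not_gt
      · rw [bandKernel_of_one_le hx, mul_zero]]
    refine lintegral_congr_ae ?_
    filter_upwards [ae_restrict_of_ae_restrict_of_subset
      (fun x (hx : x ∈ Ioo (0 : ℝ) 1) => mem_Ioi.2 hx.1) ae_bandKernel_lt_top] with u hu
    rw [← ENNReal.ofReal_toReal hu.ne, ← ENNReal.ofReal_mul (hnn _), ellipticK]
    congr 1
    have : 4 * u / (2 * T) = 2 / T * u := by field_simp; ring
    simp only [hF, this]
    ring
  have h3 : ∫ u in Ioo 0 1, U / 8 * (ellipticK u * (tanh (2 / T * u) / u)) =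
      (∫⁻ u in Ioo 0 1,
        ENNReal.ofReal (U / 8 * (ellipticK u * (tanh (2 / T * u) / u)))).toReal := by
    refine integral_eq_lintegral_of_nonneg_ae ?_ (Measurable.aestronglyMeasurable (by fun_prop))
    filter_upwards [ae_restrict_mem measurableSet_Ioo] with u hu
    have h0 := hu.1
    have := tanh_nonneg_of_nonneg (by positivity : 0 ≤ 2 / T * u)
    have := ellipticK_nonneg u
    simp only [Pi.zero_apply]; positivity
  have h4 : ∫ k, F (band 0 k) ∂momentumMeasure =
      (∫⁻ k, ENNReal.ofReal (F (band 0 k)) ∂momentumMeasure).toReal :=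
    integral_eq_lintegral_of_nonneg_ae (Eventually.of_forall fun k => hnn _)
      (hFm.comp hband).aestronglyMeasurable
  have h5 : ∫ k, F (band 0 k) ∂momentumMeasure =
      4 / π ^ 2 * (U / 8 * gapIntegral (2 / T)) := by
    rw [h4, h1, h2, ENNReal.toReal_mul, ENNReal.toReal_ofReal (by positivity), ← h3,
      integral_const_mul, gapIntegral]
  refine h5.trans ?_
  ring

theorem isNeelTemperature_iff {U T : ℝ} (hU : 0 < U) :
    IsNeelTemperature U 0 T ↔ 0 < T ∧ gapIntegral (2 / T) = 2 * π ^ 2 / U := by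
  refine and_congr_right fun hT => ?_
  rw [integral_gapEquation hU hT, eq_div_iff hU.ne', div_mul_eq_mul_div,
    eq_div_iff (by positivity), one_mul, eq_comm, mul_comm]

theorem gapIntegral_zero : gapIntegral 0 = 0 := by simp [gapIntegral]

/-- Since `tanh` is 1-Lipschitz, `G` is Lipschitz with constant `∫ K`. -/
theorem continuous_gapIntegral : Continuous gapIntegral := by
  set I := ∫ u in Ioo 0 1, ellipticK u with hI
  have hI0 : 0 ≤ I := setIntegral_nonneg measurableSet_Ioo fun u _ => ellipticK_nonneg u
  refine (LipschitzWith.of_dist_le_mul (K := ⟨I, hI0⟩) fun a b => ?_).continuous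
  rw [dist_eq, dist_eq, gapIntegral, gapIntegral,
    ← integral_sub (integrableOn_gap a) (integrableOn_gap b)]
  have h := norm_integral_le_of_norm_le (integrableOn_ellipticK.mul_const |a - b|)
    (f := fun u => ellipticK u * (tanh (a * u) / u) - ellipticK u * (tanh (b * u) / u)) ?_
  · rwa [integral_mul_const] at h
  · filter_upwards [ae_restrict_mem measurableSet_Ioo] with u hu
    rw [← mul_sub, ← sub_div, norm_mul, Real.norm_of_nonneg (ellipticK_nonneg u), norm_div,
      Real.norm_of_nonneg hu.1.le]
    refine mul_le_mul_of_nonneg_left ?_ (ellipticK_nonneg u)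
    rw [div_le_iff₀ hu.1, Real.norm_eq_abs]
    refine (abs_tanh_sub_tanh_le _ _).trans (le_of_eq ?_)
    rw [← sub_mul, abs_mul, abs_of_pos hu.1]

theorem ae_ellipticK_pos : ∀ᵐ u ∂volume.restrict (Ioo (0 : ℝ) 1), 0 < ellipticK u := by
  filter_upwards [ae_restrict_mem measurableSet_Ioo, ae_restrict_of_ae_restrict_of_subset
      (fun x (hx : x ∈ Ioo (0 : ℝ) 1) => mem_Ioi.2 hx.1) ae_bandKernel_lt_top] with u hu hK
  refine ENNReal.toReal_pos (ne_of_gt ?_) hK.ne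
  rw [bandKernel_eq hu, add_assoc]
  refine lt_of_lt_of_le ?_ le_self_add
  exact ENNReal.ofReal_pos.2 (log_pos ((one_lt_div hu.1).2 hu.2))

theorem strictMono_gapIntegral : StrictMono gapIntegral := by
  intro a b hab
  rw [← sub_pos, gapIntegral, gapIntegral,
    ← integral_sub (integrableOn_gap b) (integrableOn_gap a)]
  have hpos : ∀ᵐ u ∂volume.restrict (Ioo (0 : ℝ) 1),
      0 < ellipticK u * (tanh (b * u) / u) - ellipticK u * (tanh (a * u) / u) := by
    filter_upwards [ae_restrict_mem measurableSet_Ioo, ae_ellipticK_pos] with u hu hK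
    rw [← mul_sub, ← sub_div]
    have := sub_pos.2 (strictMono_tanh (mul_lt_mul_of_pos_right hab hu.1))
    have := hu.1
    positivity
  have hnn := hpos.mono fun u hu => hu.le
  refine (integral_nonneg_of_ae hnn).lt_of_ne fun h => ?_
  have h0 := (integral_eq_zero_iff_of_nonneg_ae hnn
    ((integrableOn_gap b).sub (integrableOn_gap a))).1 h.symm
  have hF : ∀ᵐ u ∂volume.restrict (Ioo (0 : ℝ) 1), False := by
    filter_upwards [h0, hpos] with u h1 h2
    exact h2.ne' h1
  rw [eventually_false_iff_eq_bot, ae_eq_bot, Measure.restrict_eq_zero, volume_Ioo] at hF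
  norm_num at hF

theorem tendsto_gapLog : Tendsto gapLog atTop atTop := by
  refine tendsto_atTop_mono log_four_mul_le_gapLog (tendsto_log_atTop.comp ?_)
  exact tendsto_id.const_mul_atTop (by norm_num)

/-- Unboundedness is read off from the low-temperature expansion. It is what guarantees a solution
for arbitrarily small `U`. -/
theorem tendsto_gapIntegral : Tendsto gapIntegral atTop atTop := by
  obtain ⟨C, -, hC⟩ := exists_gapIntegral_bound
  have h : Tendsto (fun a => 1 / 2 * (gapLog a * (gapLog a - C) - a₁)) atTop atTop := by
    refine Tendsto.const_mul_atTop (by norm_num) (tendsto_atTop_add_const_right _ _ ?_)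
    exact tendsto_gapLog.atTop_mul_atTop₀ (tendsto_atTop_add_const_right _ _ tendsto_gapLog)
  refine tendsto_atTop_mono' _ ?_ h
  filter_upwards [eventually_ge_atTop 1] with a ha
  have h1 := (abs_le.1 (hC a ha)).1
  have hC0 : 0 ≤ C * gapLog a / a ^ 2 := (abs_nonneg _).trans (hC a ha)
  have h2 : C * gapLog a / a ^ 2 ≤ C * gapLog a := by
    have h3 : C * gapLog a / a ^ 2 * a ^ 2 = C * gapLog a := by
      have : a ≠ 0 := by linarith
      field_simp
    have h4 := mul_le_mul_of_nonneg_left (one_le_pow₀ ha : 1 ≤ a ^ 2) hC0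
    linarith
  linarith

theorem existsUnique_gapIntegral_eq {y : ℝ} (hy : 0 < y) : ∃! a, gapIntegral a = y := by
  obtain ⟨b, hb0, hb⟩ := ((eventually_ge_atTop 0).and
    (tendsto_gapIntegral.eventually_ge_atTop y)).exists
  obtain ⟨a, -, ha⟩ := intermediate_value_Icc hb0 continuous_gapIntegral.continuousOn
    ⟨gapIntegral_zero.trans_le hy.le, hb⟩
  exact ⟨a, ha, fun c hc => strictMono_gapIntegral.injective (hc.trans ha.symm)⟩

theorem existsUnique_isNeelTemperature {U : ℝ} (hU : 0 < U) :
    ∃! T, IsNeelTemperature U 0 T := by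
  obtain ⟨a, ha, hu⟩ := existsUnique_gapIntegral_eq (by positivity : 0 < 2 * π ^ 2 / U)
  have ha0 : 0 < a := by
    rw [← strictMono_gapIntegral.lt_iff_lt, gapIntegral_zero, ha]; positivity
  refine ⟨2 / a, (isNeelTemperature_iff hU).2 ⟨by positivity, by rw [div_div_cancel₀ two_ne_zero, ha]⟩,
    fun T hT => ?_⟩
  obtain ⟨hT0, hT⟩ := (isNeelTemperature_iff hU).1 hT
  rw [← hu _ hT, div_div_cancel₀ two_ne_zero]

theorem isNeelTemperature_neelTemperature {U : ℝ} (hU : 0 < U) :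
    IsNeelTemperature U 0 (neelTemperature U 0) := by
  obtain ⟨T, hT, hu⟩ := existsUnique_isNeelTemperature hU
  have : {T : ℝ | IsNeelTemperature U 0 T} = {T} :=
    eq_singleton_iff_unique_mem.2 ⟨hT, hu⟩
  rwa [neelTemperature, this, csInf_singleton]

/-! ### Weak-coupling asymptotics of the Néel temperature. -/

theorem two_div_eq_exp_neg_gapLog {a : ℝ} (ha : 0 < a) :
    2 / a = 32 / (π * exp (-eulerMascheroniConstant)) * exp (-gapLog a) := by
  have h : exp (-gapLog a) = π / (16 * a) * exp (-eulerMascheroniConstant) := by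
    have : -gapLog a = log (π / 2) + -log (4 * a) + -log 2 + -eulerMascheroniConstant := by
      rw [gapLog]; ring
    rw [this, exp_add, exp_add, exp_add, exp_neg (log (4 * a)), exp_neg (log 2),
      exp_log (by positivity), exp_log (by positivity), exp_log (by positivity)]
    field_simp
    norm_num
  have := exp_pos (-eulerMascheroniConstant)
  rw [h]
  field_simp
  norm_num

theorem a₁_pos : 0 < a₁ := by
  have := (abs_le.1 abs_a₁_sub_le).1
  norm_num at this ⊢
  linarith

/-- At weak coupling the exponent of the Néel temperature is `√(4π²/U + a₁)` up to `O(T²)`. -/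
theorem exists_gapLog_sub_sqrt_bound : ∃ C : ℝ, 0 < C ∧ ∀ U a : ℝ, 0 < U → 1 ≤ a →
    gapIntegral a = 2 * π ^ 2 / U →
      |√(4 * π ^ 2 / U + a₁) - gapLog a| ≤ C * (2 / a) ^ 2 := by
  obtain ⟨C, hC0, hC⟩ := exists_gapIntegral_bound
  refine ⟨C, hC0, fun U a hU ha hG => ?_⟩
  have hY := one_le_gapLog ha
  have h := hC a ha
  set X := √(4 * π ^ 2 / U + a₁) with hX
  have hX0 : 0 ≤ X := sqrt_nonneg _
  have hX2 : X ^ 2 = 4 * π ^ 2 / U + a₁ := by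
    have := a₁_pos
    exact sq_sqrt (by positivity)
  -- The left side factors as a difference of squares. Since `X ≥ 0`, the factor `X + gapLog a` is
  -- at least `gapLog a` and cancels that factor in the error bound.
  have e : 2 * gapIntegral a - (gapLog a ^ 2 - a₁) = (X - gapLog a) * (X + gapLog a) := by
    rw [hG]; linear_combination -hX2
  rw [e, abs_mul, abs_of_pos (by linarith : 0 < X + gapLog a)] at h
  have h1 : |X - gapLog a| * gapLog a ≤ C / a ^ 2 * gapLog a := by
    refine le_trans ?_ (h.trans (le_of_eq (by ring)))
    exact mul_le_mul_of_nonneg_left (by linarith) (abs_nonneg _)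
  refine (le_of_mul_le_mul_right h1 (by linarith)).trans ?_
  have e2 : C * (2 / a) ^ 2 = 4 * (C / a ^ 2) := by ring
  have : 0 ≤ C / a ^ 2 := by positivity
  linarith

theorem isBigO_neelTemperature_div_sub_one :
    (fun U => neelTemperature U 0 / (32 / (π * exp (-eulerMascheroniConstant)) *
      exp (-√(4 * π ^ 2 / U + a₁))) - 1) =O[𝓝[>] (0 : ℝ)] fun U => exp (-(4 * π / √U)) := by
  obtain ⟨C, hC0, hC⟩ := exists_gapLog_sub_sqrt_bound
  set A := 32 / (π * exp (-eulerMascheroniConstant)) with hA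
  have hA0 : 0 < A := by have := exp_pos (-eulerMascheroniConstant); positivity
  -- For `a ≥ a₀` both `a ≥ 1` and `C T² = 4C/a² ≤ 1` hold. The exponent error is then at most 1, so
  -- `|e^d - 1| ≤ 2|d|` applies.
  set a₀ := 1 + √(4 * C) with ha₀
  have hlim : Tendsto (fun U : ℝ => 2 * π ^ 2 / U) (𝓝[>] 0) atTop :=
    tendsto_inv_nhdsGT_zero.const_mul_atTop (by positivity)
  refine IsBigO.of_bound (2 * C * (2 * A) ^ 2 * 4) ?_
  filter_upwards [self_mem_nhdsWithin, hlim.eventually_ge_atTop (gapIntegral a₀)] with U hU hUa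
  have hU : 0 < U := hU
  obtain ⟨hT0, hT⟩ := (isNeelTemperature_iff hU).1 (isNeelTemperature_neelTemperature hU)
  set T := neelTemperature U 0 with hTdef
  set a := 2 / T with hadef
  have ha0 : 0 < a := by positivity
  have haa : a₀ ≤ a := by rwa [← strictMono_gapIntegral.le_iff_le, hT]
  have ha1 : 1 ≤ a := by linarith [sqrt_nonneg (4 * C)]
  have hTa : T = 2 / a := by rw [hadef, div_div_cancel₀ two_ne_zero]
  have hb := hC U a hU ha1 hT
  rw [← hTa] at hb
  have hTe : T = A * exp (-gapLog a) := by rw [hTa, two_div_eq_exp_neg_gapLog ha0]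
  set X := √(4 * π ^ 2 / U + a₁) with hX
  have hCT : C * T ^ 2 ≤ 1 := by
    have h1 : √(4 * C) ≤ a := by linarith
    have h2 : 4 * C ≤ a ^ 2 := (sqrt_le_left ha0.le).1 h1
    have h3 : C * T ^ 2 = 4 * C / a ^ 2 := by rw [hTa]; ring
    rw [h3]
    exact div_le_one_of_le₀ h2 (by positivity)
  -- Positivity of `a₁` allows it to be dropped here, turning the bound `e^(-2X)` into `e^(-4π/√U)`.
  have hXl : 2 * π / √U ≤ X := by
    refine le_sqrt_of_sq_le ?_
    rw [div_pow, sq_sqrt hU.le, mul_pow]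
    have := a₁_pos
    norm_num
    linarith
  have hr : T / (A * exp (-X)) - 1 = exp (X - gapLog a) - 1 := by
    rw [hTe, mul_div_mul_left _ _ hA0.ne', ← exp_sub]; ring_nf
  have hY : T ≤ 4 * A * exp (-X) := by
    have h1 : -gapLog a ≤ 1 + -X := by linarith [(abs_le.1 (hb.trans hCT)).2]
    have h2 : exp 1 ≤ 4 := by linarith [exp_one_lt_d9]
    calc T = A * exp (-gapLog a) := hTe
      _ ≤ A * exp (1 + -X) := by gcongr
      _ = exp 1 * A * exp (-X) := by rw [exp_add]; ring
      _ ≤ _ := by gcongr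
  rw [hr, Real.norm_eq_abs, Real.norm_eq_abs, abs_exp]
  calc |exp (X - gapLog a) - 1| ≤ 2 * |X - gapLog a| := abs_exp_sub_one_le (hb.trans hCT)
    _ ≤ 2 * (C * T ^ 2) := by gcongr
    _ ≤ 2 * (C * (4 * A * exp (-X)) ^ 2) := by gcongr
    _ ≤ 2 * (C * (4 * A * exp (-(2 * π / √U))) ^ 2) := by gcongr
    _ = 2 * C * (2 * A) ^ 2 * 4 * exp (-(4 * π / √U)) := by
      have : exp (-(4 * π / √U)) = exp (-(2 * π / √U)) ^ 2 := by
        rw [← exp_nat_mul]; congr 1; push_cast; ring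
      rw [this]; ring

theorem exists_isBigO_neelTemperature_eq : ∃ r : ℝ → ℝ,
    r =O[𝓝[>] (0 : ℝ)] (fun U => exp (-(4 * π / √U))) ∧
      ∀ U : ℝ, 0 < U → neelTemperature U 0 = 32 / (π * exp (-eulerMascheroniConstant)) *
        exp (-√(4 * π ^ 2 / U + a₁)) * (1 + r U) := by
  refine ⟨_, isBigO_neelTemperature_div_sub_one, fun U _ => ?_⟩
  have := exp_pos (-eulerMascheroniConstant)
  have := exp_pos (-√(4 * π ^ 2 / U + a₁))
  rw [add_sub_cancel, mul_div_cancel₀ _ (by positivity)]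

end Hubbard

end

theorem theorem2p2 :
    -- the Néel temperature of the two-dimensional model is well defined
    (∀ U : ℝ, 0 < U → ∃! T : ℝ, Hubbard.IsNeelTemperature U 0 T) ∧
    -- the density of states `N_0` is well defined
    Hubbard.bandEnergyLaw 0 =
      volume.withDensity (fun ε => ENNReal.ofReal (Hubbard.densityOfStates 0 ε)) ∧
    -- the integrals that define `a₁` converge
    IntervalIntegrable Hubbard.densityRemainder volume 0 4 ∧
    IntegrableOn (fun x : ℝ => Real.log x ^ 2 / Real.cosh x ^ 2) (Set.Ioi 0) ∧
    -- `a₁ ≈ 0.3260` to the four decimals displayed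
    |Hubbard.a₁ - 0.3260| ≤ 0.00005 ∧
    -- the asymptotic formula
    ∃ r : ℝ → ℝ,
      r =O[𝓝[>] (0 : ℝ)] (fun U => Real.exp (-(4 * Real.pi / Real.sqrt U))) ∧
      ∀ U : ℝ, 0 < U →
        Hubbard.neelTemperature U 0 =
          32 / (Real.pi * Real.exp (-Real.eulerMascheroniConstant))
            * Real.exp (-Real.sqrt (4 * Real.pi ^ 2 / U + Hubbard.a₁)) * (1 + r U) := by
  exact ⟨fun _ => Hubbard.existsUnique_isNeelTemperature,
    Hubbard.bandEnergyLaw_eq_withDensity_densityOfStates,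
    Hubbard.intervalIntegrable_densityRemainder, Hubbard.integrableOn_log_sq_div_cosh_sq.1,
    Hubbard.abs_a₁_sub_le, Hubbard.exists_isBigO_neelTemperature_eq⟩
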